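/- Let $A,C\in\mathbb{C}^{n\times n}$ be Hermitian with $C$ indefinite (its quadratic form takes both signs). A *2D-eigentriplet* of $(A,C)$ is $(\mu,\lambda,x)\in\mathbb{R}\times\mathbb{R}\times\mathbb{C}^n$ with $(A-\mu C)x=\lambda x$, $x^HCx=0$, $x^Hx=1$. Put $$\widehat J(\mu,\lambda,x)=\begin{bmatrix}A-\mu C-\lambda I&-Cx&-x\end{bmatrix},\qquad J(\mu,\lambda,x)=\begin{bmatrix}A-\mu C-\lambda I&-Cx&-x\\-x^HC&0&0\\-x^H&0&0\end{bmatrix}.$$ A 2D-eigentriplet is *nonsingular* if $J$ is nonsingular at it, and *multiple* if $\lambda$ is an eigenvalue of $A-\mu C$ of multiplicity at least $2$. *One step of the 2D Rayleigh quotient iteration (2DRQI)* from $(\mu_k,\lambda_k,x_k)\in\mathbb{R}\times\mathbb{R}\times\mathbb{C}^n$ is defined when $J(\mu_k,\lambda_k,x_k)$ is nonsingular and the matrix $C_k$ below is indefinite. Let $\begin{bmatrix}\widetilde V_k\\R\end{bmatrix}$ ($\widetilde V_k$ of size $n\times2$) be a basis matrix of the null space of $\widehat J(\mu_k,\lambda_k,x_k)$,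 and let $V_k\in\mathbb{C}^{n\times2}$ have orthonormal columns, the same column space as $\widetilde V_k$, and $C_k=V_k^HCV_k=\mathrm{Diag}(c_1,c_2)$ with $c_1\ge c_2$. Let $A_k=V_k^HAV_k=(a_{ij})$ and $$z(\alpha)=\begin{bmatrix}\sqrt{\tfrac{-c_2}{c_1-c_2}}\\ \alpha\sqrt{\tfrac{c_1}{c_1-c_2}}\end{bmatrix},\quad \nu(\alpha)=\frac{z(\alpha)^HC_kA_kz(\alpha)}{\|C_kz(\alpha)\|^2},\quad \theta(\alpha)=z(\alpha)^HA_kz(\alpha).$$ If $a_{12}\ne0$, then $(\mu_{k+1},\lambda_{k+1},x_{k+1})=(\nu(\alpha),\theta(\alpha),V_kz(\alpha))$, where $\alpha$ is the one of the two numbers $\pm|a_{12}|/a_{12}$ for which $|\mu_k-\nu(\alpha)|+|\lambda_k-\theta(\alpha)|$ is smaller (either one in case of a tie). If $a_{12}=0$, then $\mu_{k+1}=\frac{a_{11}-a_{22}}{c_1-c_2}$, $\lambda_{k+1}=\frac{a_{22}c_1-a_{11}c_2}{c_1-c_2}$ and $x_{k+1}=V_kz(1)$. **Theorem.** Let $(\mu_*,\lambda_*,x_*)$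 be a nonsingular multiple 2D-eigentriplet of $(A,C)$, and let $\mathcal X_*$ be the set of all $x$ for which $(\mu_*,\lambda_*,x)$ is a 2D-eigentriplet. There exist positive constants $\epsilon_0,\kappa_1,\kappa_2,\kappa_3$ depending only on $(A,C,\mu_*,\lambda_*)$ such that the following holds for every $\epsilon\le\min\{1,\epsilon_0\}$. If $|\mu_k-\mu_*|\le\epsilon^2$, $|\lambda_k-\lambda_*|\le\epsilon^2$ and $\mathrm{dist}(x_k,\mathcal X_*)\le\epsilon$ (Euclidean distance), then the 2DRQI step from $(\mu_k,\lambda_k,x_k)$ is defined, and for every admissible choice of $V_k$ and $\alpha$ its result satisfies $$|\mu_{k+1}-\mu_*|\le\kappa_1\epsilon^4,\qquad |\lambda_{k+1}-\lambda_*|\le\kappa_2\epsilon^4,\qquad \mathrm{dist}(x_{k+1},\mathcal X_*)\le\kappa_3\epsilon^2 .$$ -/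

import Mathlib

/-! Two-dimensional eigenvalue problem (2DEVP) of a pair `(A, C)` of Hermitian matrices, and one
step of the two-dimensional Rayleigh quotient iteration (2DRQI). -/

namespace TwoDEVP

open Matrix

variable {n : ℕ}

/-- A Hermitian matrix is indefinite when its quadratic form takes both signs. -/
def IsIndefinite {ι : Type} [Fintype ι] (M : Matrix ι ι ℂ) : Prop :=
  (∃ y : ι → ℂ, 0 < (star y ⬝ᵥ (M *ᵥ y)).re) ∧ (∃ y : ι → ℂ, (star y ⬝ᵥ (M *ᵥ y)).re < 0)

/-- The matrix `A - μ C - lam I`. -/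
noncomputable def shifted (A C : Matrix (Fin n) (Fin n) ℂ) (μ lam : ℝ) :
    Matrix (Fin n) (Fin n) ℂ :=
  A - (μ : ℂ) • C - (lam : ℂ) • (1 : Matrix (Fin n) (Fin n) ℂ)

/-- `(μ, lam, x)` is a 2D-eigentriplet: `(A - μ C) x = lam x`, `xᴴ C x = 0`, `xᴴ x = 1`. -/
structure IsEigentriplet (A C : Matrix (Fin n) (Fin n) ℂ) (μ lam : ℝ)
    (x : EuclideanSpace ℂ (Fin n)) : Prop where
  eigen : (A - (μ : ℂ) • C) *ᵥ x.ofLp = (lam : ℂ) • x.ofLp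
  isotropic : star x.ofLp ⬝ᵥ (C *ᵥ x.ofLp) = 0
  unit : star x.ofLp ⬝ᵥ x.ofLp = 1

/-- The set of 2D-eigenvectors belonging to `(μ, lam)`. -/
def eigenvectorSet (A C : Matrix (Fin n) (Fin n) ℂ) (μ lam : ℝ) :
    Set (EuclideanSpace ℂ (Fin n)) :=
  {x | IsEigentriplet A C μ lam x}

/-- The first `n` rows `[A - μ C - lam I, -C x, -x]` of the Jacobian. -/
noncomputable def jacobianTop (A C : Matrix (Fin n) (Fin n) ℂ) (μ lam : ℝ)
    (x : EuclideanSpace ℂ (Fin n)) : Matrix (Fin n) (Fin n ⊕ Fin 2) ℂ :=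
  fromCols (shifted A C μ lam) (of fun i j => ![-(C *ᵥ x.ofLp) i, -x.ofLp i] j)

/-- The Jacobian, with last two rows `[-xᴴ C, 0, 0]` and `[-xᴴ, 0, 0]`. -/
noncomputable def jacobian (A C : Matrix (Fin n) (Fin n) ℂ) (μ lam : ℝ)
    (x : EuclideanSpace ℂ (Fin n)) : Matrix (Fin n ⊕ Fin 2) (Fin n ⊕ Fin 2) ℂ :=
  fromRows (jacobianTop A C μ lam x)
    (fromCols (of fun i j => ![-(star x.ofLp ᵥ* C) j, -(star x.ofLp) j] i) 0)

/-- A 2D-eigentriplet is nonsingular when the Jacobian at it is a nonsingular matrix. -/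
structure IsNonsingularEigentriplet (A C : Matrix (Fin n) (Fin n) ℂ) (μ lam : ℝ)
    (x : EuclideanSpace ℂ (Fin n)) : Prop extends IsEigentriplet A C μ lam x where
  nonsingular : IsUnit (jacobian A C μ lam x)

/-- The multiplicity of `lam` as an eigenvalue of `A - μ C` (this matrix is Hermitian in all uses,
so that geometric and algebraic multiplicity agree). -/
noncomputable def eigMultiplicity (A C : Matrix (Fin n) (Fin n) ℂ) (μ lam : ℝ) : ℕ :=
  Module.finrank ℂ (Module.End.eigenspace (toLin' (A - (μ : ℂ) • C)) (lam : ℂ))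

/-- The columns of `W` form a basis of the subspace `S`. -/
def IsBasisMatrix {ι : Type} (W : Matrix ι (Fin 2) ℂ) (S : Submodule ℂ (ι → ℂ)) : Prop :=
  LinearIndependent ℂ (fun j => W.col j) ∧ Submodule.span ℂ (Set.range fun j => W.col j) = S

/-- The diagonal entries `c₁` (`i = 0`) and `c₂` (`i = 1`) of `Vᴴ C V`. -/
noncomputable def cEntry (C : Matrix (Fin n) (Fin n) ℂ) (V : Matrix (Fin n) (Fin 2) ℂ)
    (i : Fin 2) : ℝ :=
  ((Vᴴ * C * V) i i).re

/-- `V` is a projection matrix of the iteration at `(μ, lam, x)`: an orthonormal basis matrix of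
the column space of the first `n` rows `W` of a basis matrix `[W; R]` of the null space of
`[A - μ C - lam I, -C x, -x]`, such that `Vᴴ C V = Diag(c₁, c₂)` with `c₁ ≥ c₂`. -/
structure IsProjectionMatrix (A C : Matrix (Fin n) (Fin n) ℂ) (μ lam : ℝ)
    (x : EuclideanSpace ℂ (Fin n)) (V : Matrix (Fin n) (Fin 2) ℂ) : Prop where
  orthonormal : Vᴴ * V = 1
  range_eq : ∃ (W : Matrix (Fin n) (Fin 2) ℂ) (R : Matrix (Fin 2) (Fin 2) ℂ),
    IsBasisMatrix (fromRows W R) (LinearMap.ker (jacobianTop A C μ lam x).mulVecLin) ∧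
    LinearMap.range V.mulVecLin = LinearMap.range W.mulVecLin
  diag : Vᴴ * C * V = diagonal fun i => (cEntry C V i : ℂ)
  ordered : cEntry C V 1 ≤ cEntry C V 0

/-- `z(α) = (√(-c₂ / (c₁ - c₂)), α √(c₁ / (c₁ - c₂)))`. -/
noncomputable def ritzVec (C : Matrix (Fin n) (Fin n) ℂ) (V : Matrix (Fin n) (Fin 2) ℂ)
    (α : ℂ) : Fin 2 → ℂ :=
  ![((Real.sqrt (-cEntry C V 1 / (cEntry C V 0 - cEntry C V 1)) : ℝ) : ℂ),
    α * ((Real.sqrt (cEntry C V 0 / (cEntry C V 0 - cEntry C V 1)) : ℝ) : ℂ)]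

/-- `ν(α) = z(α)ᴴ C_k A_k z(α) / ‖C_k z(α)‖²` with `A_k = Vᴴ A V`, `C_k = Vᴴ C V`. The numerator is
real for the values of `α` that the iteration uses. -/
noncomputable def ritzNu (A C : Matrix (Fin n) (Fin n) ℂ) (V : Matrix (Fin n) (Fin 2) ℂ)
    (α : ℂ) : ℝ :=
  (star (ritzVec C V α) ⬝ᵥ (((Vᴴ * C * V) * (Vᴴ * A * V)) *ᵥ ritzVec C V α)).re /
    ‖WithLp.toLp 2 ((Vᴴ * C * V) *ᵥ ritzVec C V α)‖ ^ 2

/-- `θ(α) = z(α)ᴴ A_k z(α)` with `A_k = Vᴴ A V` (a real number, `A` being Hermitian). -/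
noncomputable def ritzTheta (A C : Matrix (Fin n) (Fin n) ℂ) (V : Matrix (Fin n) (Fin 2) ℂ)
    (α : ℂ) : ℝ :=
  (star (ritzVec C V α) ⬝ᵥ ((Vᴴ * A * V) *ᵥ ritzVec C V α)).re

/-- The two values `± |a₁₂| / a₁₂`, where `a₁₂` is the `(1,2)` entry of `Vᴴ A V`. -/
noncomputable def phases (A : Matrix (Fin n) (Fin n) ℂ) (V : Matrix (Fin n) (Fin 2) ℂ) : Set ℂ :=
  {(‖(Vᴴ * A * V) 0 1‖ : ℂ) / (Vᴴ * A * V) 0 1, -((‖(Vᴴ * A * V) 0 1‖ : ℂ) / (Vᴴ * A * V) 0 1)}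

/-- The update when `a₁₂ ≠ 0`: of the two 2D Ritz triplets `(ν(α), θ(α), V z(α))`, take one for
which `|μ - ν(α)| + |lam - θ(α)|` is smallest. -/
def IsSimpleUpdate (A C : Matrix (Fin n) (Fin n) ℂ) (V : Matrix (Fin n) (Fin 2) ℂ)
    (μ lam μ' lam' : ℝ) (x' : EuclideanSpace ℂ (Fin n)) : Prop :=
  ∃ α ∈ phases A V,
    (∀ β ∈ phases A V, |μ - ritzNu A C V α| + |lam - ritzTheta A C V α| ≤
      |μ - ritzNu A C V β| + |lam - ritzTheta A C V β|) ∧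
    μ' = ritzNu A C V α ∧ lam' = ritzTheta A C V α ∧
    x' = WithLp.toLp 2 (V *ᵥ ritzVec C V α)

/-- The update when `a₁₂ = 0`:
`μ' = (a₁₁ - a₂₂) / (c₁ - c₂)`, `lam' = (a₂₂ c₁ - a₁₁ c₂) / (c₁ - c₂)`, `x' = V z(1)`. -/
def IsMultipleUpdate (A C : Matrix (Fin n) (Fin n) ℂ) (V : Matrix (Fin n) (Fin 2) ℂ)
    (μ' lam' : ℝ) (x' : EuclideanSpace ℂ (Fin n)) : Prop :=
  μ' = (((Vᴴ * A * V) 0 0).re - ((Vᴴ * A * V) 1 1).re) / (cEntry C V 0 - cEntry C V 1) ∧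
  lam' = (((Vᴴ * A * V) 1 1).re * cEntry C V 0 - ((Vᴴ * A * V) 0 0).re * cEntry C V 1) /
    (cEntry C V 0 - cEntry C V 1) ∧
  x' = WithLp.toLp 2 (V *ᵥ ritzVec C V 1)

/-- `(μ', lam', x')` results from `(μ, lam, x)` by one well-defined step of the 2DRQI: the Jacobian
at `(μ, lam, x)` is nonsingular, `Vᴴ C V` is indefinite for the projection matrix `V`, and the
update is performed. A relation, because `V` is unique only up to phases of its columns and because
the two candidates may tie. -/
def IsStep (A C : Matrix (Fin n) (Fin n) ℂ) (μ lam : ℝ) (x : EuclideanSpace ℂ (Fin n))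
    (μ' lam' : ℝ) (x' : EuclideanSpace ℂ (Fin n)) : Prop :=
  IsUnit (jacobian A C μ lam x) ∧
  ∃ V : Matrix (Fin n) (Fin 2) ℂ, IsProjectionMatrix A C μ lam x V ∧
    IsIndefinite (Vᴴ * C * V) ∧
    (((Vᴴ * A * V) 0 1 ≠ 0 ∧ IsSimpleUpdate A C V μ lam μ' lam' x') ∨
     ((Vᴴ * A * V) 0 1 = 0 ∧ IsMultipleUpdate A C V μ' lam' x'))

end TwoDEVP

/-! Let M = A - μ* C - λ* I and S = ker M. Nonsingularity makes q ↦ (⟪C x*, q⟫, ⟪x*, q⟫) injective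
on S, so multiplicity at least 2 forces dim S = 2, and C is then indefinite on S
(`exists_isDiagonalFrame_of_nonsingular`). In an orthonormal basis of S that diagonalises the
compression of C, all unit isotropic vectors have the same nonzero coordinate moduli. Every bound is
therefore uniform over the eigenvector set.

The projection subspace consists of vectors p with (A - μ C - λ I) p = a C x + b x. Since the range
of M is orthogonal to S, projecting onto S removes M p and leaves P(a C x + b x) = O(ε²)‖p‖. Hence
a, b and M p are O(ε²)‖p‖, and p lies within O(ε²)‖p‖ of S
(`IsDiagonalFrame.exists_perturbation_bounds`). The error of x enters only multiplied by a and b,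
which is why order ε suffices for it.

A symmetric M annihilates S on both sides, so Vᴴ M V = O(ε⁴): up to that error A_k is μ* C_k + λ* I
(`isNearPencil_of_near`). For this exact pencil every unit isotropic z gives ν = μ* and θ = λ*, so
both phases α succeed, and the formulas for a₁₂ = 0 are equally stable (`update_estimates`). The
Ritz vector is unit, isotropic and O(ε²)-close to S, and adjusting its coordinate moduli inside S
moves it into the eigenvector set at cost O(ε²) (`IsDiagonalFrame.exists_isotropic_near_of_near`).
-/

namespace TwoDEVP

open scoped InnerProductSpace ComplexConjugate

/-! ### Hermitian forms on a two-dimensional subspace -/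

section Frame

variable {H : Type*} [NormedAddCommGroup H] [InnerProductSpace ℂ H]

/-- `u` is an orthonormal basis of `S` in which the compression of `C` to `S` is `Diag(d 0, d 1)`. -/
structure IsDiagonalFrame (C : H →L[ℂ] H) (S : Submodule ℂ H) (u : Fin 2 → H) (d : Fin 2 → ℝ) :
    Prop where
  orthonormal : Orthonormal ℂ u
  span_eq : Submodule.span ℂ (Set.range u) = S
  inner_apply : ∀ i j, ⟪u i, C (u j)⟫_ℂ = if i = j then (d i : ℂ) else 0

/-- The spectral theorem for the compression of `C` to `S`, with the eigenvalues in decreasing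
order. -/
theorem exists_isDiagonalFrame [FiniteDimensional ℂ H] {C : H →L[ℂ] H}
    (hC : (C : H →ₗ[ℂ] H).IsSymmetric) {S : Submodule ℂ H} (hS : Module.finrank ℂ S = 2) :
    ∃ u d, IsDiagonalFrame C S u d ∧ d 1 ≤ d 0 := by
  let T : S →ₗ[ℂ] S :=
    (S.orthogonalProjectionOnto : H →ₗ[ℂ] S) ∘ₗ (C : H →ₗ[ℂ] H) ∘ₗ S.subtype
  have hin : ∀ p q : S, ⟪p, T q⟫_ℂ = ⟪(p : H), C q⟫_ℂ := fun p q => by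
    change ⟪(p : H), (S.orthogonalProjectionOnto (C q) : H)⟫_ℂ = _
    rw [← Submodule.coe_inner, Submodule.inner_orthogonalProjectionOnto_eq_of_mem_left]
  have hT : T.IsSymmetric := fun p q => by
    rw [hin, ← inner_conj_symm, hin, inner_conj_symm]
    exact hC p q
  let b := hT.eigenvectorBasis hS
  refine ⟨fun i => b i, hT.eigenvalues hS, ⟨?_, ?_, ?_⟩, hT.eigenvalues_antitone hS (by simp)⟩
  · exact b.orthonormal.comp_linearIsometry S.subtypeₗᵢ
  · have h : Set.range (fun i => (b i : H)) = S.subtype '' Set.range b := by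
      ext; simp
    rw [h, Submodule.span_image, ← b.coe_toBasis, b.toBasis.span_eq]
    simp
  · intro i j
    rw [← hin, hT.apply_eigenvectorBasis hS j, inner_smul_right]
    have := (orthonormal_iff_ite.mp b.orthonormal) i j
    simp only [b] at this
    rw [this]
    split_ifs with h <;> simp [h]

namespace IsDiagonalFrame

variable {C : H →L[ℂ] H} {S : Submodule ℂ H} {u : Fin 2 → H} {d : Fin 2 → ℝ}

theorem mem (h : IsDiagonalFrame C S u d) (i : Fin 2) : u i ∈ S :=
  h.span_eq ▸ Submodule.subset_span ⟨i, rfl⟩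

theorem norm_eq_one (h : IsDiagonalFrame C S u d) (i : Fin 2) : ‖u i‖ = 1 := h.orthonormal.1 i

theorem inner_eq (h : IsDiagonalFrame C S u d) (i j : Fin 2) :
    ⟪u i, u j⟫_ℂ = if i = j then 1 else 0 := orthonormal_iff_ite.mp h.orthonormal i j

theorem finrank_eq (h : IsDiagonalFrame C S u d) : Module.finrank ℂ S = 2 := by
  rw [← h.span_eq, finrank_span_eq_card h.orthonormal.linearIndependent, Fintype.card_fin]

theorem eq_add (h : IsDiagonalFrame C S u d) {p : H} (hp : p ∈ S) :
    p = ⟪u 0, p⟫_ℂ • u 0 + ⟪u 1, p⟫_ℂ • u 1 := by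
  rw [← h.span_eq, Submodule.mem_span_range_iff_exists_fun] at hp
  obtain ⟨c, rfl⟩ := hp
  simp only [Fin.sum_univ_two, inner_add_right, inner_smul_right, h.inner_eq]
  simp

theorem inner_apply_coord (h : IsDiagonalFrame C S u d) {p : H} (hp : p ∈ S) (i : Fin 2) :
    ⟪u i, C p⟫_ℂ = d i * ⟪u i, p⟫_ℂ := by
  conv_lhs => rw [h.eq_add hp]
  fin_cases i <;> simp only [map_add, map_smul, inner_add_right, inner_smul_right, h.inner_apply] <;>
    simp <;> ring

theorem inner_left (h : IsDiagonalFrame C S u d) {p : H} (hp : p ∈ S) (q : H) :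
    ⟪p, q⟫_ℂ = conj ⟪u 0, p⟫_ℂ * ⟪u 0, q⟫_ℂ + conj ⟪u 1, p⟫_ℂ * ⟪u 1, q⟫_ℂ := by
  conv_lhs => rw [h.eq_add hp]
  simp only [inner_add_left, inner_smul_left]

theorem norm_sq_eq (h : IsDiagonalFrame C S u d) {p : H} (hp : p ∈ S) :
    ‖p‖ ^ 2 = ‖⟪u 0, p⟫_ℂ‖ ^ 2 + ‖⟪u 1, p⟫_ℂ‖ ^ 2 := by
  have := h.inner_left hp p
  rw [inner_self_eq_norm_sq_to_K, Complex.conj_mul', Complex.conj_mul'] at this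
  refine Complex.ofReal_injective ?_
  push_cast
  exact this

theorem inner_apply_self (h : IsDiagonalFrame C S u d) {p : H} (hp : p ∈ S) :
    ⟪p, C p⟫_ℂ = ((d 0 * ‖⟪u 0, p⟫_ℂ‖ ^ 2 + d 1 * ‖⟪u 1, p⟫_ℂ‖ ^ 2 : ℝ) : ℂ) := by
  rw [h.inner_left hp, h.inner_apply_coord hp, h.inner_apply_coord hp]
  push_cast
  rw [← Complex.conj_mul', ← Complex.conj_mul']
  ring

theorem norm_coord_le (h : IsDiagonalFrame C S u d) (p : H) (i : Fin 2) :
    ‖⟪u i, p⟫_ℂ‖ ≤ ‖p‖ := by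
  simpa [h.norm_eq_one] using norm_inner_le_norm (𝕜 := ℂ) (u i) p

theorem norm_le (h : IsDiagonalFrame C S u d) {p : H} (hp : p ∈ S) :
    ‖p‖ ≤ ‖⟪u 0, p⟫_ℂ‖ + ‖⟪u 1, p⟫_ℂ‖ := by
  conv_lhs => rw [h.eq_add hp]
  refine (norm_add_le _ _).trans_eq ?_
  simp [norm_smul, h.norm_eq_one]

/-- The squared moduli of the coordinates of a unit isotropic vector. -/
theorem coord_sq (h : IsDiagonalFrame C S u d) (hd0 : 0 < d 0) (hd1 : d 1 < 0) {x : H}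
    (hx : x ∈ S) (hx1 : ‖x‖ = 1) (hxC : ⟪x, C x⟫_ℂ = 0) :
    ‖⟪u 0, x⟫_ℂ‖ ^ 2 = -d 1 / (d 0 - d 1) ∧ ‖⟪u 1, x⟫_ℂ‖ ^ 2 = d 0 / (d 0 - d 1) := by
  have h1 := h.norm_sq_eq hx
  rw [h.inner_apply_self hx] at hxC
  norm_cast at hxC
  rw [hx1] at h1
  have hD : d 0 - d 1 ≠ 0 := by linarith
  rw [eq_div_iff hD, eq_div_iff hD]
  constructor
  · linear_combination hxC + d 1 * h1
  · linear_combination -hxC - d 0 * h1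

/-- The map `q ↦ (⟪C x, q⟫, ⟪x, q⟫)` on `S` is bounded below, and so is its adjoint, uniformly in the
unit isotropic vectors `x` of `S`. -/
theorem exists_isotropic_bounds [FiniteDimensional ℂ H] (h : IsDiagonalFrame C S u d)
    (hC : (C : H →ₗ[ℂ] H).IsSymmetric) (hd0 : 0 < d 0) (hd1 : d 1 < 0) :
    ∃ κ : ℝ, 0 < κ ∧ ∀ x ∈ S, ‖x‖ = 1 → ⟪x, C x⟫_ℂ = 0 →
      (∀ q ∈ S, ‖q‖ ≤ κ * (‖⟪C x, q⟫_ℂ‖ + ‖⟪x, q⟫_ℂ‖)) ∧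
      ∀ a b : ℂ, ‖a‖ + ‖b‖ ≤ κ * ‖S.starProjection (a • C x + b • x)‖ := by
  have hD : 0 < d 0 - d 1 := by linarith
  -- The coordinate moduli of a unit isotropic vector are determined by `d` alone; `s` is the
  -- smaller of the two, so `κ` does not depend on `x`.
  obtain ⟨s, hs0, hsa, hsb⟩ : ∃ s : ℝ, 0 < s ∧ s ^ 2 ≤ -d 1 / (d 0 - d 1) ∧
      s ^ 2 ≤ d 0 / (d 0 - d 1) := by
    have hm : 0 < min (-d 1 / (d 0 - d 1)) (d 0 / (d 0 - d 1)) :=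
      lt_min (div_pos (by linarith) hD) (div_pos hd0 hD)
    refine ⟨√_, Real.sqrt_pos.mpr hm, ?_⟩
    rw [Real.sq_sqrt hm.le]
    exact ⟨min_le_left _ _, min_le_right _ _⟩
  have hκ1 : 0 < (2 + d 0 - d 1) / ((d 0 - d 1) * s) := by
    apply div_pos <;> [linarith; positivity]
  have hκ2 : 0 < 2 / ((d 0 - d 1) * s ^ 2) + 1 := by positivity
  refine ⟨(2 + d 0 - d 1) / ((d 0 - d 1) * s) + (2 / ((d 0 - d 1) * s ^ 2) + 1), by linarith, ?_⟩
  intro x hx hx1 hxC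
  obtain ⟨h0, h1⟩ := h.coord_sq hd0 hd1 hx hx1 hxC
  have hw0 : s ≤ ‖⟪u 0, x⟫_ℂ‖ := abs_le_of_sq_le_sq' (h0 ▸ hsa) (norm_nonneg _) |>.2
  have hw1 : s ≤ ‖⟪u 1, x⟫_ℂ‖ := abs_le_of_sq_le_sq' (h1 ▸ hsb) (norm_nonneg _) |>.2
  constructor
  · intro q hq
    have es := h.inner_left hx q
    have et : ⟪C x, q⟫_ℂ = conj ⟪u 0, x⟫_ℂ * (d 0 * ⟪u 0, q⟫_ℂ) +
        conj ⟪u 1, x⟫_ℂ * (d 1 * ⟪u 1, q⟫_ℂ) := by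
      rw [← h.inner_apply_coord hq, ← h.inner_apply_coord hq, ← h.inner_left hx (C q)]
      exact hC x q
    set σ := ⟪x, q⟫_ℂ
    set τ := ⟪C x, q⟫_ℂ
    -- `σ` and `τ` are linear combinations of the two products of coordinates of `x` and `q`; the
    -- 2×2 system has determinant ±(`d 0 - d 1`) and is solved by elimination.
    have e0 : ((d 0 - d 1 : ℝ) : ℂ) * conj ⟪u 0, x⟫_ℂ * ⟪u 0, q⟫_ℂ = τ - (d 1 : ℂ) * σ := by
      push_cast; linear_combination (d 1 : ℂ) * es - et
    have e1 : ((d 0 - d 1 : ℝ) : ℂ) * conj ⟪u 1, x⟫_ℂ * ⟪u 1, q⟫_ℂ = (d 0 : ℂ) * σ - τ := by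
      push_cast; linear_combination et - (d 0 : ℂ) * es
    have n0 : (d 0 - d 1) * s * ‖⟪u 0, q⟫_ℂ‖ ≤ ‖τ‖ + (-d 1) * ‖σ‖ := by
      calc _ ≤ (d 0 - d 1) * ‖⟪u 0, x⟫_ℂ‖ * ‖⟪u 0, q⟫_ℂ‖ := by gcongr
        _ = ‖((d 0 - d 1 : ℝ) : ℂ) * conj ⟪u 0, x⟫_ℂ * ⟪u 0, q⟫_ℂ‖ := by
          rw [norm_mul, norm_mul, Complex.norm_real, Real.norm_of_nonneg hD.le, RCLike.norm_conj]
        _ ≤ _ := by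
          rw [e0]
          refine (norm_sub_le _ _).trans_eq ?_
          rw [norm_mul, Complex.norm_real, Real.norm_of_nonpos hd1.le]
    have n1 : (d 0 - d 1) * s * ‖⟪u 1, q⟫_ℂ‖ ≤ d 0 * ‖σ‖ + ‖τ‖ := by
      calc _ ≤ (d 0 - d 1) * ‖⟪u 1, x⟫_ℂ‖ * ‖⟪u 1, q⟫_ℂ‖ := by gcongr
        _ = ‖((d 0 - d 1 : ℝ) : ℂ) * conj ⟪u 1, x⟫_ℂ * ⟪u 1, q⟫_ℂ‖ := by
          rw [norm_mul, norm_mul, Complex.norm_real, Real.norm_of_nonneg hD.le, RCLike.norm_conj]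
        _ ≤ _ := by
          rw [e1]
          refine (norm_sub_le _ _).trans_eq ?_
          rw [norm_mul, Complex.norm_real, Real.norm_of_nonneg hd0.le]
    have hDs : 0 < (d 0 - d 1) * s := by positivity
    have key : ‖q‖ ≤ (2 + d 0 - d 1) / ((d 0 - d 1) * s) * (‖τ‖ + ‖σ‖) := by
      rw [div_mul_eq_mul_div, le_div_iff₀ hDs]
      have := h.norm_le hq
      nlinarith [norm_nonneg τ, norm_nonneg σ, mul_le_mul_of_nonneg_left this hDs.le,
        mul_nonneg hD.le (norm_nonneg τ)]
    refine key.trans ?_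
    gcongr
    linarith
  · intro a b
    set y := S.starProjection (a • C x + b • x) with hy
    have hyi : ∀ p ∈ S, ⟪p, y⟫_ℂ = ⟪p, a • C x + b • x⟫_ℂ := fun p hp => by
      rw [hy, ← Submodule.inner_starProjection_left_eq_right,
        Submodule.starProjection_eq_self_iff.mpr hp]
    have hyu : ∀ i, ⟪u i, y⟫_ℂ = (a * d i + b) * ⟪u i, x⟫_ℂ := fun i => by
      rw [hyi _ (h.mem i), inner_add_right, inner_smul_right, inner_smul_right,
        h.inner_apply_coord hx]
      ring
    -- Isotropy makes `x` orthogonal to `C x`, so pairing `y` with `x` isolates `b`. The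
    -- antisymmetric combination of coordinates used for `ha` eliminates `b` and isolates `a`.
    have hb : ‖b‖ ≤ ‖y‖ := by
      have : ⟪x, y⟫_ℂ = b := by
        rw [hyi x hx, inner_add_right, inner_smul_right, inner_smul_right, hxC,
          inner_self_eq_norm_sq_to_K, hx1]
        simp
      rw [← this]
      simpa [hx1] using norm_inner_le_norm (𝕜 := ℂ) x y
    have hle : ∀ i, ‖⟪u i, x⟫_ℂ‖ ≤ 1 := fun i => hx1 ▸ h.norm_coord_le x i
    have ha : (d 0 - d 1) * s ^ 2 * ‖a‖ ≤ 2 * ‖y‖ := by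
      have e : ⟪u 1, x⟫_ℂ * ⟪u 0, y⟫_ℂ - ⟪u 0, x⟫_ℂ * ⟪u 1, y⟫_ℂ =
          ((d 0 - d 1 : ℝ) : ℂ) * (⟪u 0, x⟫_ℂ * ⟪u 1, x⟫_ℂ) * a := by
        rw [hyu, hyu]; push_cast; ring
      calc _ ≤ (d 0 - d 1) * (‖⟪u 0, x⟫_ℂ‖ * ‖⟪u 1, x⟫_ℂ‖) * ‖a‖ := by
            rw [sq]; gcongr
        _ = ‖⟪u 1, x⟫_ℂ * ⟪u 0, y⟫_ℂ - ⟪u 0, x⟫_ℂ * ⟪u 1, y⟫_ℂ‖ := by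
          rw [e, norm_mul, norm_mul, norm_mul, Complex.norm_real, Real.norm_of_nonneg hD.le]
        _ ≤ 1 * ‖y‖ + 1 * ‖y‖ := by
          refine (norm_sub_le _ _).trans ?_
          rw [norm_mul, norm_mul]
          gcongr
          exacts [hle 1, h.norm_coord_le y 0, hle 0, h.norm_coord_le y 1]
        _ = _ := by ring
    have hDs : 0 < (d 0 - d 1) * s ^ 2 := by positivity
    have ha' : ‖a‖ ≤ 2 / ((d 0 - d 1) * s ^ 2) * ‖y‖ := by
      rw [div_mul_eq_mul_div, le_div_iff₀ hDs]; linarith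
    nlinarith [mul_nonneg hκ1.le (norm_nonneg y)]

/-- A vector of `S` that is nearly unit and nearly isotropic is near a unit isotropic vector. -/
theorem exists_isotropic_near (h : IsDiagonalFrame C S u d) (hd0 : 0 < d 0) (hd1 : d 1 < 0) :
    ∃ κ : ℝ, 0 < κ ∧ ∀ y ∈ S, ∀ η : ℝ, |‖y‖ ^ 2 - 1| ≤ η → ‖⟪y, C y⟫_ℂ‖ ≤ η →
      ∃ x ∈ S, ‖x‖ = 1 ∧ ⟪x, C x⟫_ℂ = 0 ∧ ‖y - x‖ ≤ κ * η := by
  have hD : 0 < d 0 - d 1 := by linarith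
  have hq0 : 0 < -d 1 / (d 0 - d 1) := div_pos (by linarith) hD
  have hq1 : 0 < d 0 / (d 0 - d 1) := div_pos hd0 hD
  set s0 := √(-d 1 / (d 0 - d 1)) with hs0
  set s1 := √(d 0 / (d 0 - d 1)) with hs1
  have p0 : 0 < s0 := Real.sqrt_pos.mpr hq0
  have p1 : 0 < s1 := Real.sqrt_pos.mpr hq1
  have q0 : s0 ^ 2 = -d 1 / (d 0 - d 1) := Real.sq_sqrt hq0.le
  have q1 : s1 ^ 2 = d 0 / (d 0 - d 1) := Real.sq_sqrt hq1.le
  -- Keep the phase of `z` and replace its modulus by `s`. The bound is the factorisation of ‖z‖² -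
  -- s², whose factor ‖z‖ + s is at least s.
  have hphase : ∀ (z : ℂ) (s : ℝ), 0 < s → ∃ w : ℂ, ‖w‖ = s ∧ ‖z - w‖ * s ≤ |‖z‖ ^ 2 - s ^ 2| := by
    intro z s hs
    by_cases hz : z = 0
    · refine ⟨s, by simp [abs_of_pos hs], ?_⟩
      simp [hz, sq, abs_of_pos hs]
    · have hz' : (‖z‖ : ℂ) ≠ 0 := by exact_mod_cast norm_ne_zero_iff.mpr hz
      refine ⟨s * (z / ‖z‖), by simp [abs_of_pos hs, hz], ?_⟩
      have : z - s * (z / ‖z‖) = ((‖z‖ - s : ℝ) : ℂ) * (z / ‖z‖) := by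
        push_cast; field_simp
      rw [this, norm_mul, norm_div, Complex.norm_real, Complex.norm_real, norm_norm,
        div_self (norm_ne_zero_iff.mpr hz), mul_one, sq_sub_sq, abs_mul, mul_comm,
        Real.norm_eq_abs]
      gcongr
      exact (le_add_of_nonneg_left (norm_nonneg z)).trans (le_abs_self _)
  refine ⟨(1 - d 1) / ((d 0 - d 1) * s0) + (1 + d 0) / ((d 0 - d 1) * s1), ?_, ?_⟩
  · have : 0 < 1 - d 1 := by linarith
    positivity
  intro y hy η hη1 hη2
  obtain ⟨w0, hw0, e0⟩ := hphase ⟪u 0, y⟫_ℂ s0 p0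
  obtain ⟨w1, hw1, e1⟩ := hphase ⟪u 1, y⟫_ℂ s1 p1
  have hx : w0 • u 0 + w1 • u 1 ∈ S :=
    S.add_mem (S.smul_mem _ (h.mem 0)) (S.smul_mem _ (h.mem 1))
  have hc0 : ⟪u 0, w0 • u 0 + w1 • u 1⟫_ℂ = w0 := by
    simp only [inner_add_right, inner_smul_right, h.inner_eq]
    simp
  have hc1 : ⟪u 1, w0 • u 0 + w1 • u 1⟫_ℂ = w1 := by
    simp only [inner_add_right, inner_smul_right, h.inner_eq]
    simp
  refine ⟨_, hx, ?_, ?_, ?_⟩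
  · have := h.norm_sq_eq hx
    rw [hc0, hc1, hw0, hw1, q0, q1, ← add_div] at this
    rw [neg_add_eq_sub, div_self hD.ne'] at this
    exact (pow_eq_one_iff_of_nonneg (norm_nonneg _) two_ne_zero).mp this
  · rw [h.inner_apply_self hx, hc0, hc1, hw0, hw1, q0, q1]
    norm_cast
    ring
  · have hn := h.norm_le (S.sub_mem hy hx)
    rw [inner_sub_right, inner_sub_right, hc0, hc1] at hn
    have hN := h.norm_sq_eq hy
    rw [h.inner_apply_self hy, Complex.norm_real, Real.norm_eq_abs] at hη2
    rw [abs_le] at hη1 hη2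
    have b0 : ‖⟪u 0, y⟫_ℂ - w0‖ ≤ (1 - d 1) / ((d 0 - d 1) * s0) * η := by
      rw [div_mul_eq_mul_div, le_div_iff₀ (by positivity)]
      -- Without the absolute value the left side equals ⟪y, C y⟫ - `d 1` (‖y‖² - 1), whence the
      -- factor `1 - d 1`. For the other coordinate it is `d 0` (‖y‖² - 1) - ⟪y, C y⟫.
      have : (d 0 - d 1) * |‖⟪u 0, y⟫_ℂ‖ ^ 2 - s0 ^ 2| ≤ (1 - d 1) * η := by
        rw [q0, ← abs_of_pos hD, ← abs_mul, mul_sub, abs_of_pos hD, mul_div_cancel₀ _ hD.ne',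
          abs_le]
        constructor <;> nlinarith
      nlinarith
    have b1 : ‖⟪u 1, y⟫_ℂ - w1‖ ≤ (1 + d 0) / ((d 0 - d 1) * s1) * η := by
      rw [div_mul_eq_mul_div, le_div_iff₀ (by positivity)]
      have : (d 0 - d 1) * |‖⟪u 1, y⟫_ℂ‖ ^ 2 - s1 ^ 2| ≤ (1 + d 0) * η := by
        rw [q1, ← abs_of_pos hD, ← abs_mul, mul_sub, abs_of_pos hD, mul_div_cancel₀ _ hD.ne',
          abs_le]
        constructor <;> nlinarith
      nlinarith
    linarith

end IsDiagonalFrame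

end Frame

end TwoDEVP

namespace TwoDEVP

open scoped InnerProductSpace ComplexConjugate

/-! ### Perturbation of the kernel of a symmetric operator -/

section Perturbation

variable {H : Type*} [NormedAddCommGroup H] [InnerProductSpace ℂ H] [FiniteDimensional ℂ H]

/-- `M` is injective on the orthogonal complement of its kernel, hence bounded below there by finite
dimension. -/
theorem exists_norm_sub_starProjection_ker_le (M : H →L[ℂ] H) :
    ∃ g : ℝ, 0 < g ∧ ∀ p, ‖p - (LinearMap.ker (M : H →ₗ[ℂ] H)).starProjection p‖ ≤ g * ‖M p‖ := by
  set S := LinearMap.ker (M : H →ₗ[ℂ] H)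
  obtain ⟨K, hK, hanti⟩ := ((M : H →ₗ[ℂ] H) ∘ₗ Sᗮ.subtype).exists_antilipschitzWith (by
    rw [LinearMap.ker_eq_bot']
    rintro ⟨p, hp⟩ hMp
    have h2 : p ∈ S := hMp
    have := Submodule.inner_right_of_mem_orthogonal h2 hp
    simpa using this)
  refine ⟨K, by exact_mod_cast hK, fun p => ?_⟩
  have h1 := hanti.le_mul_dist ⟨p - S.starProjection p, S.sub_starProjection_mem_orthogonal p⟩ 0
  have h3 : M (S.starProjection p) = 0 := S.starProjection_apply_mem p
  simpa [dist_eq_norm, h3] using h1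

/-- The source of the doubled order: for vectors within η of the kernel, the form of `M` is O(η²).
-/
theorem inner_apply_eq_of_ker {M : H →L[ℂ] H} (hM : (M : H →ₗ[ℂ] H).IsSymmetric) (p q : H) :
    ⟪p, M q⟫_ℂ = ⟪p - (LinearMap.ker (M : H →ₗ[ℂ] H)).starProjection p,
      M (q - (LinearMap.ker (M : H →ₗ[ℂ] H)).starProjection q)⟫_ℂ := by
  set S := LinearMap.ker (M : H →ₗ[ℂ] H)
  have h : ∀ p, M (S.starProjection p) = 0 := fun p => S.starProjection_apply_mem p
  have h2 : ⟪S.starProjection p, M q⟫_ℂ = 0 := by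
    have := hM (S.starProjection p) q
    simp only [ContinuousLinearMap.coe_coe] at this
    rw [← this, h, inner_zero_left]
  rw [map_sub, h, sub_zero, inner_sub_left, h2, sub_zero]

theorem starProjection_ker_apply_eq_zero {M : H →L[ℂ] H} (hM : (M : H →ₗ[ℂ] H).IsSymmetric)
    (p : H) : (LinearMap.ker (M : H →ₗ[ℂ] H)).starProjection (M p) = 0 := by
  rw [Submodule.starProjection_apply_eq_zero_iff]
  intro q hq
  have := hM q p
  simp only [ContinuousLinearMap.coe_coe] at this
  rw [← this, show M q = 0 from hq, inner_zero_left]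

/-- Solutions of the perturbed bordered equations lie near the kernel, and the bordered equations are
uniquely solvable. -/
theorem IsDiagonalFrame.exists_perturbation_bounds {M C : H →L[ℂ] H}
    {u : Fin 2 → H} {d : Fin 2 → ℝ}
    (h : IsDiagonalFrame C (LinearMap.ker (M : H →ₗ[ℂ] H)) u d)
    (hM : (M : H →ₗ[ℂ] H).IsSymmetric)
    (hC : (C : H →ₗ[ℂ] H).IsSymmetric) (hd0 : 0 < d 0) (hd1 : d 1 < 0) :
    ∃ ε₀ κ : ℝ, 0 < ε₀ ∧ 0 < κ ∧ ∀ (ε s t : ℝ) (x xs : H), 0 ≤ ε → ε ≤ 1 → ε ≤ ε₀ →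
      |s| ≤ ε ^ 2 → |t| ≤ ε ^ 2 → M xs = 0 → ‖xs‖ = 1 → ⟪xs, C xs⟫_ℂ = 0 → ‖x - xs‖ ≤ ε →
      ∀ (p : H) (a b : ℂ), M p - (s : ℂ) • C p - (t : ℂ) • p = a • C x + b • x →
        ‖p - (LinearMap.ker (M : H →ₗ[ℂ] H)).starProjection p‖ ≤ κ * ε ^ 2 * ‖p‖ ∧
        (⟪C x, p⟫_ℂ = 0 → ⟪x, p⟫_ℂ = 0 → p = 0 ∧ a = 0 ∧ b = 0) := by
  obtain ⟨g, hg0, hg⟩ := exists_norm_sub_starProjection_ker_le M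
  have hPM := starProjection_ker_apply_eq_zero hM
  obtain ⟨κ, hκ0, hκ⟩ := h.exists_isotropic_bounds hC hd0 hd1
  set S := LinearMap.ker (M : H →ₗ[ℂ] H)
  set c := ‖C‖ + 1 with hc
  have hc0 : 1 ≤ c := by simp [hc]
  have hCle : ∀ p, ‖C p‖ ≤ ‖C‖ * ‖p‖ := C.le_opNorm
  set κ1 := 2 * κ * c with hκ1
  have hκ10 : 0 < κ1 := by positivity
  set κ2 := g * (c + 2 * κ1 * c) with hκ2
  have hκ20 : 0 < κ2 := by positivity
  set κ3 := κ * (2 * c * (κ2 + 1)) + κ2 with hκ3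
  have hκ30 : 0 < κ3 := by positivity
  -- The first threshold absorbs the cost of replacing `x` by `xs` in the estimate of `a` and `b`;
  -- the second turns the final bound ‖p‖ ≤ κ3 ε ‖p‖ into p = 0.
  refine ⟨min (1 / (2 * κ * c)) (1 / (2 * κ3)), κ2, by positivity, hκ20, ?_⟩
  intro ε s t x xs hε0 hε1 hεm hs ht hxs hx1 hxC hx p a b heq
  have hεa : 2 * κ * c * ε ≤ 1 := by
    have := (le_div_iff₀ (by positivity)).mp (hεm.trans (min_le_left _ _))
    linarith
  have hεb : 2 * κ3 * ε ≤ 1 := by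
    have := (le_div_iff₀ (by positivity)).mp (hεm.trans (min_le_right _ _))
    linarith
  have hε2 : ε ^ 2 ≤ ε := by nlinarith
  obtain ⟨hκa, hκb⟩ := hκ xs hxs hx1 hxC
  have hPle := S.norm_starProjection_apply_le
  have hst : ‖(s : ℂ) • C p + (t : ℂ) • p‖ ≤ c * ε ^ 2 * ‖p‖ := by
    calc _ ≤ |s| * ‖C p‖ + |t| * ‖p‖ := by
          refine (norm_add_le _ _).trans_eq ?_
          rw [norm_smul, norm_smul, Complex.norm_real, Complex.norm_real]; rfl
      _ ≤ ε ^ 2 * (‖C‖ * ‖p‖) + ε ^ 2 * ‖p‖ := by gcongr; exact hCle p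
      _ = _ := by rw [hc]; ring
  -- The range of `M` is orthogonal to its kernel, so the projection removes `M p`.
  have hP : S.starProjection (a • C x + b • x) =
      -S.starProjection ((s : ℂ) • C p + (t : ℂ) • p) := by
    rw [← heq, sub_sub, map_sub, hPM, zero_sub]
  have hsplit : a • C xs + b • xs = (a • C x + b • x) - (a • C (x - xs) + b • (x - xs)) := by
    rw [map_sub, smul_sub, smul_sub]; abel
  have hdiff : ‖a • C (x - xs) + b • (x - xs)‖ ≤ c * ε * (‖a‖ + ‖b‖) := by
    calc _ ≤ ‖a‖ * ‖C (x - xs)‖ + ‖b‖ * ‖x - xs‖ := by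
          refine (norm_add_le _ _).trans_eq ?_
          rw [norm_smul, norm_smul]
      _ ≤ ‖a‖ * (‖C‖ * ε) + ‖b‖ * ε := by
          gcongr
          exact (hCle _).trans (by gcongr)
      _ ≤ _ := by
          rw [hc]
          have h1 : 0 ≤ ‖C‖ * ε * ‖b‖ := by positivity
          have h2 : 0 ≤ ε * ‖a‖ := by positivity
          nlinarith
  -- The lower bound at `xs` leaves an error κ c ε (‖a‖ + ‖b‖), at most half of the left side.
  have hab : ‖a‖ + ‖b‖ ≤ κ1 * ε ^ 2 * ‖p‖ := by
    have h1 := hκb a b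
    rw [hsplit, map_sub, hP] at h1
    have h2 : ‖-S.starProjection ((s : ℂ) • C p + (t : ℂ) • p) -
        S.starProjection (a • C (x - xs) + b • (x - xs))‖ ≤
        c * ε ^ 2 * ‖p‖ + c * ε * (‖a‖ + ‖b‖) := by
      refine (norm_sub_le _ _).trans (add_le_add ?_ ((hPle _).trans hdiff))
      rw [norm_neg]
      exact (hPle _).trans hst
    have h3 := h1.trans (mul_le_mul_of_nonneg_left h2 hκ0.le)
    have h4 : 2 * κ * c * ε * (‖a‖ + ‖b‖) ≤ 1 * (‖a‖ + ‖b‖) := by gcongr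
    rw [hκ1]
    linarith
  have hMp : ‖M p‖ ≤ (c + 2 * κ1 * c) * ε ^ 2 * ‖p‖ := by
    have e1 : M p = ((s : ℂ) • C p + (t : ℂ) • p) + (a • C x + b • x) := by
      rw [← heq]; abel
    have hx2 : ‖x‖ ≤ 2 := by
      have : x = xs + (x - xs) := by abel
      rw [this]
      exact (norm_add_le _ _).trans (by linarith)
    have h5 : ‖a • C x + b • x‖ ≤ 2 * c * (‖a‖ + ‖b‖) := by
      calc _ ≤ ‖a‖ * ‖C x‖ + ‖b‖ * ‖x‖ := by
            refine (norm_add_le _ _).trans_eq ?_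
            rw [norm_smul, norm_smul]
        _ ≤ ‖a‖ * (‖C‖ * 2) + ‖b‖ * 2 := by
            gcongr
            exact (hCle _).trans (by gcongr)
        _ ≤ _ := by
            rw [hc]
            have h1 : 0 ≤ ‖C‖ * ‖b‖ := by positivity
            nlinarith [norm_nonneg a]
    rw [e1]
    refine (norm_add_le _ _).trans ?_
    have := mul_le_mul_of_nonneg_left hab (show 0 ≤ 2 * c by positivity)
    linarith
  have hpp : ‖p - S.starProjection p‖ ≤ κ2 * ε ^ 2 * ‖p‖ := by
    refine (hg p).trans ?_
    rw [hκ2]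
    have := mul_le_mul_of_nonneg_left hMp hg0.le
    linarith
  refine ⟨hpp, fun h1 h2 => ?_⟩
  have hpp' : ‖p - S.starProjection p‖ ≤ κ2 * ε * ‖p‖ := hpp.trans (by gcongr)
  -- The projection `q` of `p` is orthogonal to `xs` and `C xs` up to O(ε)‖p‖, so the lower bound on
  -- `S` makes `q`, and with it `p`, of size O(ε)‖p‖.
  have hp0 : p = 0 := by
    set q := S.starProjection p
    have b2 : ‖⟪xs, q⟫_ℂ‖ ≤ (κ2 + 1) * ε * ‖p‖ := by
      have e : ⟪xs, q⟫_ℂ = -⟪x - xs, p⟫_ℂ - ⟪xs, p - q⟫_ℂ := by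
        rw [inner_sub_left, inner_sub_right, h2]; ring
      rw [e]
      refine (norm_sub_le _ _).trans ?_
      rw [norm_neg]
      have i1 : ‖⟪x - xs, p⟫_ℂ‖ ≤ ε * ‖p‖ := (norm_inner_le_norm _ _).trans (by gcongr)
      have i2 : ‖⟪xs, p - q⟫_ℂ‖ ≤ κ2 * ε * ‖p‖ :=
        (norm_inner_le_norm _ _).trans (by rw [hx1, one_mul]; exact hpp')
      linarith
    have b1 : ‖⟪C xs, q⟫_ℂ‖ ≤ ‖C‖ * ((κ2 + 1) * ε * ‖p‖) := by
      have e : ⟪C xs, q⟫_ℂ = -⟪C (x - xs), p⟫_ℂ - ⟪C xs, p - q⟫_ℂ := by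
        rw [map_sub, inner_sub_left, inner_sub_right, h1]; ring
      rw [e]
      refine (norm_sub_le _ _).trans ?_
      rw [norm_neg]
      have i1 : ‖⟪C (x - xs), p⟫_ℂ‖ ≤ ‖C‖ * ε * ‖p‖ :=
        (norm_inner_le_norm _ _).trans (by gcongr; exact (hCle _).trans (by gcongr))
      have i2 : ‖⟪C xs, p - q⟫_ℂ‖ ≤ ‖C‖ * (κ2 * ε * ‖p‖) :=
        (norm_inner_le_norm _ _).trans (by
          gcongr
          simpa [hx1] using hCle xs)
      linarith
    have hq := hκa q (S.starProjection_apply_mem p)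
    have h6 : ‖p‖ ≤ ‖q‖ + ‖p - q‖ := by
      simpa using norm_add_le q (p - q)
    have h7 : κ * (‖⟪C xs, q⟫_ℂ‖ + ‖⟪xs, q⟫_ℂ‖) ≤ κ * (c * ((κ2 + 1) * ε * ‖p‖)) := by
      gcongr
      rw [hc]; linarith
    have h8 : 0 ≤ κ * (c * ((κ2 + 1) * ε * ‖p‖)) := by positivity
    have h9 : ‖p‖ ≤ κ3 * ε * ‖p‖ := by
      rw [hκ3]; linarith
    have h10 : 2 * κ3 * ε * ‖p‖ ≤ 1 * ‖p‖ := by gcongr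
    have : ‖p‖ ≤ 0 := by linarith
    exact norm_le_zero_iff.mp this
  rw [hp0, norm_zero, mul_zero] at hab
  refine ⟨hp0, norm_le_zero_iff.mp ?_, norm_le_zero_iff.mp ?_⟩ <;>
    linarith [norm_nonneg a, norm_nonneg b]

/-- A two-dimensional space near `S` inherits the indefiniteness of `C` on `S`. -/
theorem IsDiagonalFrame.indefinite_of_near {C : H →L[ℂ] H} {S Q : Submodule ℂ H}
    {u v : Fin 2 → H} {d c : Fin 2 → ℝ} (h : IsDiagonalFrame C S u d)
    (hv : IsDiagonalFrame C Q v c) (hC : (C : H →ₗ[ℂ] H).IsSymmetric) {η : ℝ} (hη0 : 0 ≤ η)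
    (hη : η ≤ 1 / 2) (hη2 : 16 * ‖C‖ * η ≤ min (d 0) (-d 1))
    (hd0 : 0 < d 0) (hd1 : d 1 < 0)
    (hord : c 1 ≤ c 0)
    (hQ : ∀ p ∈ Q, ‖p - S.starProjection p‖ ≤ η * ‖p‖) :
    d 0 / 8 ≤ c 0 ∧ c 1 ≤ d 1 / 8 := by
  have hlow : ∀ p ∈ Q, ‖p‖ ≤ 2 * ‖S.starProjection p‖ := fun p hp => by
    have h1 : ‖p‖ ≤ ‖S.starProjection p‖ + ‖p - S.starProjection p‖ := by
      simpa using norm_add_le (S.starProjection p) (p - S.starProjection p)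
    have := hQ p hp
    nlinarith [norm_nonneg p]
  -- Projection onto `S` is injective on `Q` and the dimensions agree, so each `u i` is the
  -- projection of some vector of `Q`. There the form of `C` is close to `d i`.
  let T : Q →ₗ[ℂ] S := (S.orthogonalProjectionOnto : H →ₗ[ℂ] S) ∘ₗ Q.subtype
  have hT : ∀ p : Q, (T p : H) = S.starProjection p := fun p => rfl
  have hsurj : Function.Surjective T := by
    rw [← LinearMap.injective_iff_surjective_of_finrank_eq_finrank
      (hv.finrank_eq.trans h.finrank_eq.symm), injective_iff_map_eq_zero]
    intro p hp
    have h1 := hlow p p.2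
    rw [← hT, hp] at h1
    simpa using h1
  have key : ∀ i, ∃ p ∈ Q, 1 ≤ ‖p‖ ∧ ‖p‖ ≤ 2 ∧ |RCLike.re ⟪p, C p⟫_ℂ - d i| ≤ 8 * ‖C‖ * η := by
    intro i
    obtain ⟨p, hp⟩ := hsurj ⟨u i, h.mem i⟩
    have hpu : S.starProjection p = u i := by rw [← hT, hp]
    have h2 : ‖(p : H)‖ ≤ 2 := by simpa [hpu, h.norm_eq_one] using hlow p p.2
    refine ⟨p, p.2, ?_, h2, ?_⟩
    · have := S.norm_starProjection_apply_le (p : H)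
      rwa [hpu, h.norm_eq_one] at this
    · have h3 : ‖(p : H) - u i‖ ≤ η * 2 := by
        have := hQ p p.2
        rw [hpu] at this
        exact this.trans (by gcongr)
      have e : ⟪(p : H), C p⟫_ℂ - ⟪u i, C (u i)⟫_ℂ =
          ⟪(p : H) - u i, C p⟫_ℂ + ⟪C (u i), (p : H) - u i⟫_ℂ := by
        have := hC (u i) (p - u i)
        simp only [ContinuousLinearMap.coe_coe] at this
        rw [this, map_sub, inner_sub_left, inner_sub_right]; ring
      have hd : ⟪u i, C (u i)⟫_ℂ = d i := by simp [h.inner_apply]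
      have e2 : RCLike.re ⟪(p : H), C p⟫_ℂ - d i =
          RCLike.re (⟪(p : H) - u i, C p⟫_ℂ + ⟪C (u i), (p : H) - u i⟫_ℂ) := by
        rw [← e, map_sub, hd]; simp
      rw [e2]
      refine (RCLike.abs_re_le_norm _).trans ((norm_add_le _ _).trans ?_)
      have i1 : ‖⟪(p : H) - u i, C p⟫_ℂ‖ ≤ (η * 2) * (‖C‖ * 2) :=
        (norm_inner_le_norm _ _).trans (by
          gcongr
          exact (C.le_opNorm _).trans (by gcongr))
      have i2 : ‖⟪C (u i), (p : H) - u i⟫_ℂ‖ ≤ ‖C‖ * (η * 2) :=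
        (norm_inner_le_norm _ _).trans (by
          gcongr
          simpa [h.norm_eq_one] using C.le_opNorm (u i))
      nlinarith [mul_nonneg (norm_nonneg C) hη0]
  -- `c 1` and `c 0` bound the Rayleigh quotient on `Q`. At the vectors of `key` the form keeps the
  -- sign of `d i` and at least half its size, and ‖p‖² ≤ 4; hence the factor 1/8.
  have hquad : ∀ p ∈ Q, c 1 * ‖p‖ ^ 2 ≤ RCLike.re ⟪p, C p⟫_ℂ ∧
      RCLike.re ⟪p, C p⟫_ℂ ≤ c 0 * ‖p‖ ^ 2 := fun p hp => by
    rw [hv.inner_apply_self hp, hv.norm_sq_eq hp]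
    simp only [RCLike.re_to_complex, Complex.ofReal_re]
    constructor <;> nlinarith [sq_nonneg ‖⟪v 0, p⟫_ℂ‖, sq_nonneg ‖⟪v 1, p⟫_ℂ‖]
  constructor
  · obtain ⟨p, hp, hp1, hp2, hpd⟩ := key 0
    have := (hquad p hp).2
    have h4 := hη2.trans (min_le_left _ _)
    rw [abs_le] at hpd
    have h5 : ‖p‖ ^ 2 ≤ 4 := by nlinarith
    have h6 : 0 < ‖p‖ ^ 2 := by positivity
    have h7 : 0 < c 0 := by
      by_contra hcon
      nlinarith
    nlinarith
  · obtain ⟨p, hp, hp1, hp2, hpd⟩ := key 1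
    have := (hquad p hp).1
    have h4 := hη2.trans (min_le_right _ _)
    rw [abs_le] at hpd
    have h5 : ‖p‖ ^ 2 ≤ 4 := by nlinarith
    have h6 : 0 < ‖p‖ ^ 2 := by positivity
    have h7 : c 1 < 0 := by
      by_contra hcon
      nlinarith
    nlinarith

/-- A unit isotropic vector near `S` is near a unit isotropic vector of `S`. -/
theorem IsDiagonalFrame.exists_isotropic_near_of_near {C : H →L[ℂ] H} {S : Submodule ℂ H}
    {u : Fin 2 → H} {d : Fin 2 → ℝ} (h : IsDiagonalFrame C S u d)
    (hC : (C : H →ₗ[ℂ] H).IsSymmetric) (hd0 : 0 < d 0) (hd1 : d 1 < 0) :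
    ∃ κ : ℝ, 0 < κ ∧ ∀ (y : H) (η : ℝ), η ≤ 1 → ‖y‖ = 1 → ⟪y, C y⟫_ℂ = 0 →
      ‖y - S.starProjection y‖ ≤ η →
      ∃ x ∈ S, ‖x‖ = 1 ∧ ⟪x, C x⟫_ℂ = 0 ∧ ‖y - x‖ ≤ κ * η := by
  obtain ⟨κ, hκ0, hκ⟩ := h.exists_isotropic_near hd0 hd1
  refine ⟨1 + κ * (2 * (‖C‖ + 1)), by positivity, ?_⟩
  intro y η hη1 hy1 hyC hy
  set q := S.starProjection y with hq
  have hη0 : 0 ≤ η := (norm_nonneg _).trans hy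
  have hq1 : ‖q‖ ≤ 1 := hy1 ▸ S.norm_starProjection_apply_le y
  have hq2 : 1 ≤ ‖q‖ + η := by
    have : ‖y‖ ≤ ‖q‖ + ‖y - q‖ := by simpa using norm_add_le q (y - q)
    linarith
  -- Projecting `y` onto `S` changes its squared norm by at most 2η and the form by at most 2‖C‖η;
  -- both defects are then corrected inside `S`.
  obtain ⟨x, hxS, hx1, hxC, hx⟩ := hκ q (S.starProjection_apply_mem y) (2 * (‖C‖ + 1) * η)
    (by
      rw [abs_le]
      have := mul_nonneg (norm_nonneg C) hη0
      constructor <;> nlinarith [norm_nonneg q])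
    (by
      have e : ⟪q, C q⟫_ℂ = -⟪C q, y - q⟫_ℂ - ⟪y - q, C y⟫_ℂ := by
        have := hC q (y - q)
        simp only [ContinuousLinearMap.coe_coe] at this
        rw [this, map_sub, inner_sub_left, inner_sub_right, hyC]; ring
      rw [e]
      refine (norm_sub_le _ _).trans ?_
      rw [norm_neg]
      have i1 : ‖⟪C q, y - q⟫_ℂ‖ ≤ ‖C‖ * 1 * η :=
        (norm_inner_le_norm _ _).trans (by
          gcongr
          exact (C.le_opNorm _).trans (by gcongr))
      have i2 : ‖⟪y - q, C y⟫_ℂ‖ ≤ η * ‖C‖ :=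
        (norm_inner_le_norm _ _).trans (by
          gcongr
          simpa [hy1] using C.le_opNorm y)
      linarith)
  refine ⟨x, hxS, hx1, hxC, ?_⟩
  have : ‖y - x‖ ≤ ‖y - q‖ + ‖q - x‖ := by simpa using norm_add_le (y - q) (q - x)
  linarith

end Perturbation

end TwoDEVP

namespace TwoDEVP

open Matrix
open scoped InnerProductSpace ComplexConjugate

/-! ### Ritz values of a 2×2 pencil near μ C_k + λ I -/

section Ritz

variable {n : ℕ} {A C : Matrix (Fin n) (Fin n) ℂ} {V : Matrix (Fin n) (Fin 2) ℂ}

theorem normSq_ritzVec_zero (h0 : 0 < cEntry C V 0) (h1 : cEntry C V 1 < 0) (α : ℂ) :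
    ‖ritzVec C V α 0‖ ^ 2 = -cEntry C V 1 / (cEntry C V 0 - cEntry C V 1) := by
  have : 0 ≤ -cEntry C V 1 / (cEntry C V 0 - cEntry C V 1) :=
    div_nonneg (by linarith) (by linarith)
  simp [ritzVec, Real.sq_sqrt this]

theorem normSq_ritzVec_one (h0 : 0 < cEntry C V 0) (h1 : cEntry C V 1 < 0) {α : ℂ}
    (hα : ‖α‖ = 1) :
    ‖ritzVec C V α 1‖ ^ 2 = cEntry C V 0 / (cEntry C V 0 - cEntry C V 1) := by
  have : 0 ≤ cEntry C V 0 / (cEntry C V 0 - cEntry C V 1) := div_nonneg (by linarith) (by linarith)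
  simp [ritzVec, hα, Real.sq_sqrt this]

theorem normSq_ritzVec_add (h0 : 0 < cEntry C V 0) (h1 : cEntry C V 1 < 0) {α : ℂ}
    (hα : ‖α‖ = 1) : ‖ritzVec C V α 0‖ ^ 2 + ‖ritzVec C V α 1‖ ^ 2 = 1 := by
  rw [normSq_ritzVec_zero h0 h1, normSq_ritzVec_one h0 h1 hα, ← add_div, neg_add_eq_sub,
    div_self (by linarith)]

theorem isotropic_ritzVec (h0 : 0 < cEntry C V 0) (h1 : cEntry C V 1 < 0) {α : ℂ}
    (hα : ‖α‖ = 1) :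
    cEntry C V 0 * ‖ritzVec C V α 0‖ ^ 2 + cEntry C V 1 * ‖ritzVec C V α 1‖ ^ 2 = 0 := by
  rw [normSq_ritzVec_zero h0 h1, normSq_ritzVec_one h0 h1 hα]
  ring

theorem norm_ritzVec_le (h0 : 0 < cEntry C V 0) (h1 : cEntry C V 1 < 0) {α : ℂ}
    (hα : ‖α‖ = 1) (i : Fin 2) : ‖ritzVec C V α i‖ ≤ 1 := by
  have := normSq_ritzVec_add h0 h1 hα
  rw [← sq_le_one_iff₀ (norm_nonneg _)]
  fin_cases i
  · simp only [Fin.zero_eta]; nlinarith [sq_nonneg ‖ritzVec C V α 1‖]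
  · simp only [Fin.mk_one]; nlinarith [sq_nonneg ‖ritzVec C V α 0‖]

/-- `Vᴴ A V` is within `η` of `μ Vᴴ C V + lam I`, entrywise. -/
def IsNearPencil (A C : Matrix (Fin n) (Fin n) ℂ) (V : Matrix (Fin n) (Fin 2) ℂ) (μ lam η : ℝ) :
    Prop :=
  ∀ i j, ‖(Vᴴ * A * V) i j - (if i = j then ((μ * cEntry C V i + lam : ℝ) : ℂ) else 0)‖ ≤ η

theorem norm_sum_ritzVec_le (h0 : 0 < cEntry C V 0) (h1 : cEntry C V 1 < 0) {α : ℂ}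
    (hα : ‖α‖ = 1) {R : Fin 2 → Fin 2 → ℂ} {η : ℝ} (hR : ∀ i j, ‖R i j‖ ≤ η) (i j : Fin 2) :
    ‖conj (ritzVec C V α i) * R i j * ritzVec C V α j‖ ≤ η := by
  have hz := norm_ritzVec_le h0 h1 hα
  have hη : 0 ≤ η := (norm_nonneg _).trans (hR i j)
  calc _ = ‖ritzVec C V α i‖ * ‖R i j‖ * ‖ritzVec C V α j‖ := by
        rw [norm_mul, norm_mul, RCLike.norm_conj]
    _ ≤ 1 * η * 1 := by
        gcongr
        exacts [hz i, hR i j, hz j]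
    _ = η := by ring

/-- For a unit isotropic z, zᴴ(μ C_k + λ I)z = λ; the four entries of the error contribute at most η
each. -/
theorem abs_ritzTheta_sub_le {μ lam η : ℝ} (hη : IsNearPencil A C V μ lam η)
    (h0 : 0 < cEntry C V 0) (h1 : cEntry C V 1 < 0) {α : ℂ} (hα : ‖α‖ = 1) :
    |ritzTheta A C V α - lam| ≤ 4 * η := by
  have hb := norm_sum_ritzVec_le h0 h1 hα hη
  have hn := normSq_ritzVec_add h0 h1 hα
  have hi := isotropic_ritzVec h0 h1 hα
  set z := ritzVec C V α with hz
  have e : star z ⬝ᵥ ((Vᴴ * A * V) *ᵥ z) - (lam : ℂ) =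
      ∑ i, ∑ j, conj (z i) * ((Vᴴ * A * V) i j -
        (if i = j then ((μ * cEntry C V i + lam : ℝ) : ℂ) else 0)) * z j := by
    have hn' : conj (z 0) * z 0 + conj (z 1) * z 1 = (1 : ℂ) := by
      rw [Complex.conj_mul', Complex.conj_mul']; exact_mod_cast hn
    have hi' : (cEntry C V 0 : ℂ) * (conj (z 0) * z 0) +
        (cEntry C V 1 : ℂ) * (conj (z 1) * z 1) = 0 := by
      rw [Complex.conj_mul', Complex.conj_mul']; exact_mod_cast hi
    simp only [dotProduct, mulVec, Fin.sum_univ_two, Pi.star_apply, RCLike.star_def,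
      Fin.isValue, if_true, zero_ne_one, one_ne_zero, if_false, Complex.ofReal_add,
      Complex.ofReal_mul]
    linear_combination (lam : ℂ) * hn' + (μ : ℂ) * hi'
  have e2 : ritzTheta A C V α - lam = (star z ⬝ᵥ ((Vᴴ * A * V) *ᵥ z) - (lam : ℂ)).re := by
    simp [ritzTheta, hz]
  rw [e2, e]
  refine (Complex.abs_re_le_norm _).trans ?_
  rw [Fin.sum_univ_two, Fin.sum_univ_two, Fin.sum_univ_two]
  refine (norm_add_le _ _).trans ?_
  have a1 := norm_add_le_of_le (hb 0 0) (hb 0 1)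
  have a2 := norm_add_le_of_le (hb 1 0) (hb 1 1)
  linarith

/-- By isotropy zᴴ C_k(μ C_k + λ I)z = μ‖C_k z‖², and ‖C_k z‖² = -c₁c₂. The error is at most 2η(c₁ -
c₂)/(-c₁c₂) = 2η(1/c₁ + 1/(-c₂)) ≤ 4η/δ. -/
theorem abs_ritzNu_sub_le {μ lam η δ : ℝ} (hη : IsNearPencil A C V μ lam η)
    (hdiag : Vᴴ * C * V = diagonal fun i => (cEntry C V i : ℂ)) (hδ : 0 < δ)
    (h0 : δ ≤ cEntry C V 0) (h1 : cEntry C V 1 ≤ -δ) {α : ℂ} (hα : ‖α‖ = 1) :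
    |ritzNu A C V α - μ| ≤ 4 * η / δ := by
  have h0' : 0 < cEntry C V 0 := by linarith
  have h1' : cEntry C V 1 < 0 := by linarith
  have hη0 : 0 ≤ η := (norm_nonneg _).trans (hη 0 0)
  have hb := norm_sum_ritzVec_le h0' h1' hα hη
  have hi := isotropic_ritzVec h0' h1' hα
  have hq0 := normSq_ritzVec_zero h0' h1' α
  have hq1 := normSq_ritzVec_one h0' h1' hα
  set z := ritzVec C V α with hz
  set c0 := cEntry C V 0 with hc0
  set c1 := cEntry C V 1 with hc1
  have hden : ‖WithLp.toLp 2 ((Vᴴ * C * V) *ᵥ z)‖ ^ 2 = c0 ^ 2 * ‖z 0‖ ^ 2 + c1 ^ 2 * ‖z 1‖ ^ 2 := by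
    rw [EuclideanSpace.norm_sq_eq, Fin.sum_univ_two, hdiag]
    simp [mulVec_diagonal, mul_pow, ← hc0, ← hc1]
  have hden2 : c0 ^ 2 * ‖z 0‖ ^ 2 + c1 ^ 2 * ‖z 1‖ ^ 2 = -(c0 * c1) := by
    have : c0 - c1 ≠ 0 := by linarith
    rw [hq0, hq1]
    field_simp
    ring
  have hpos : 0 < -(c0 * c1) := by nlinarith
  have e : star z ⬝ᵥ (((Vᴴ * C * V) * (Vᴴ * A * V)) *ᵥ z) - ((μ * -(c0 * c1) : ℝ) : ℂ) =
      ∑ i, (cEntry C V i : ℂ) * ∑ j, conj (z i) * ((Vᴴ * A * V) i j -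
        (if i = j then ((μ * cEntry C V i + lam : ℝ) : ℂ) else 0)) * z j := by
    have hn' : (c0 : ℂ) ^ 2 * (conj (z 0) * z 0) + (c1 : ℂ) ^ 2 * (conj (z 1) * z 1) =
        ((-(c0 * c1) : ℝ) : ℂ) := by
      rw [Complex.conj_mul', Complex.conj_mul', ← hden2]; push_cast; ring
    have hi' : (c0 : ℂ) * (conj (z 0) * z 0) + (c1 : ℂ) * (conj (z 1) * z 1) = 0 := by
      rw [Complex.conj_mul', Complex.conj_mul']; exact_mod_cast hi
    rw [hdiag, Complex.ofReal_mul, ← hn']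
    simp only [dotProduct, mulVec, Fin.sum_univ_two, Pi.star_apply, RCLike.star_def,
      diagonal_mul, Fin.isValue, if_true, zero_ne_one, one_ne_zero, if_false, Complex.ofReal_add,
      Complex.ofReal_mul, ← hc0, ← hc1]
    linear_combination (lam : ℂ) * hi'
  have e2 : ritzNu A C V α - μ =
      (star z ⬝ᵥ (((Vᴴ * C * V) * (Vᴴ * A * V)) *ᵥ z) - ((μ * -(c0 * c1) : ℝ) : ℂ)).re /
        -(c0 * c1) := by
    rw [ritzNu, ← hz, hden, hden2, Complex.sub_re, Complex.ofReal_re, sub_div,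
      mul_div_cancel_right₀ _ hpos.ne']
  rw [e2, abs_div, abs_of_pos hpos, div_le_div_iff₀ hpos hδ, e]
  have hbound : |(∑ i, (cEntry C V i : ℂ) * ∑ j, conj (z i) * ((Vᴴ * A * V) i j -
        (if i = j then ((μ * cEntry C V i + lam : ℝ) : ℂ) else 0)) * z j).re| ≤
      (c0 - c1) * (2 * η) := by
    refine (Complex.abs_re_le_norm _).trans ?_
    have a1 := norm_add_le_of_le (hb 0 0) (hb 0 1)
    have a2 := norm_add_le_of_le (hb 1 0) (hb 1 1)
    rw [Fin.sum_univ_two]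
    refine (norm_add_le _ _).trans ?_
    rw [norm_mul, norm_mul, Complex.norm_real, Complex.norm_real, ← hc0, ← hc1,
      Real.norm_of_nonneg h0'.le, Real.norm_of_nonpos h1'.le, Fin.sum_univ_two, Fin.sum_univ_two]
    have b1 := mul_le_mul_of_nonneg_left a1 h0'.le
    have b2 := mul_le_mul_of_nonneg_left a2 (neg_nonneg.mpr h1'.le)
    linarith
  refine (mul_le_mul_of_nonneg_right hbound hδ.le).trans ?_
  have k1 : c0 * δ ≤ c0 * -c1 := by gcongr; linarith
  have k2 : -c1 * δ ≤ -c1 * c0 := by gcongr; linarith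
  nlinarith

theorem norm_eq_one_of_mem_phases (h : (Vᴴ * A * V) 0 1 ≠ 0) {α : ℂ} (hα : α ∈ phases A V) :
    ‖α‖ = 1 := by
  have : ‖(‖(Vᴴ * A * V) 0 1‖ : ℂ) / (Vᴴ * A * V) 0 1‖ = 1 := by
    rw [norm_div, Complex.norm_real, norm_norm, div_self (norm_ne_zero_iff.mpr h)]
  rcases hα with rfl | rfl
  · exact this
  · rw [norm_neg, this]

/-- The updated pair solves a_ii = μ' c_i + λ' exactly. The error of λ' is a convex combination of
the two diagonal errors, and that of μ' is their difference divided by c₁ - c₂. -/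
theorem abs_multipleUpdate_sub_le {μ lam η δ : ℝ} (hη : IsNearPencil A C V μ lam η) (hδ : 0 < δ)
    (h0 : δ ≤ cEntry C V 0) (h1 : cEntry C V 1 ≤ -δ) {μ' lam' : ℝ}
    {x' : EuclideanSpace ℂ (Fin n)} (h : IsMultipleUpdate A C V μ' lam' x') :
    |μ' - μ| ≤ 4 * η / δ ∧ |lam' - lam| ≤ 4 * η := by
  have hre : ∀ i, |((Vᴴ * A * V) i i).re - (μ * cEntry C V i + lam)| ≤ η := fun i => by
    have := (Complex.abs_re_le_norm _).trans (hη i i)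
    simpa using this
  have e0 := hre 0
  have e1 := hre 1
  obtain ⟨rfl, rfl, -⟩ := h
  set c0 := cEntry C V 0
  set c1 := cEntry C V 1
  set a0 := ((Vᴴ * A * V) 0 0).re
  set a1 := ((Vᴴ * A * V) 1 1).re
  have hη0 : 0 ≤ η := (abs_nonneg _).trans e0
  have hD : 0 < c0 - c1 := by linarith
  rw [abs_le] at e0 e1
  constructor
  · have : (a0 - a1) / (c0 - c1) - μ = (a0 - a1 - μ * (c0 - c1)) / (c0 - c1) := by
      field_simp
    rw [this, abs_div, abs_of_pos hD, div_le_div_iff₀ hD hδ]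
    have : |a0 - a1 - μ * (c0 - c1)| ≤ 2 * η := by
      rw [abs_le]; constructor <;> nlinarith
    nlinarith
  · have : (a1 * c0 - a0 * c1) / (c0 - c1) - lam =
        (c0 * (a1 - (μ * c1 + lam)) + -c1 * (a0 - (μ * c0 + lam))) / (c0 - c1) := by
      field_simp
      ring
    rw [this, abs_div, abs_of_pos hD, div_le_iff₀ hD, abs_le]
    have hc0 : 0 ≤ c0 := by linarith
    have hc1 : 0 ≤ -c1 := by linarith
    constructor <;> nlinarith [mul_le_mul_of_nonneg_left e0.1 hc1,
      mul_le_mul_of_nonneg_left e0.2 hc1, mul_le_mul_of_nonneg_left e1.1 hc0,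
      mul_le_mul_of_nonneg_left e1.2 hc0, mul_nonneg hD.le hη0]

end Ritz

end TwoDEVP

namespace TwoDEVP

open Matrix
open scoped InnerProductSpace ComplexConjugate

/-! ### From matrices to operators on Euclidean space -/

section Translation

variable {n : ℕ}

/-- The operator on Euclidean space given by a square matrix. -/
noncomputable abbrev op (B : Matrix (Fin n) (Fin n) ℂ) :
    EuclideanSpace ℂ (Fin n) →L[ℂ] EuclideanSpace ℂ (Fin n) :=
  toEuclideanCLM (n := Fin n) (𝕜 := ℂ) B

theorem inner_op (B : Matrix (Fin n) (Fin n) ℂ) (x y : EuclideanSpace ℂ (Fin n)) :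
    ⟪x, op B y⟫_ℂ = star x.ofLp ⬝ᵥ (B *ᵥ y.ofLp) := by
  rw [EuclideanSpace.inner_eq_star_dotProduct, ofLp_toEuclideanCLM, dotProduct_comm]

theorem isSymmetric_op {B : Matrix (Fin n) (Fin n) ℂ} (hB : B.IsHermitian) :
    (op B : EuclideanSpace ℂ (Fin n) →ₗ[ℂ] EuclideanSpace ℂ (Fin n)).IsSymmetric :=
  isSymmetric_toEuclideanLin_iff.mpr hB

theorem isHermitian_shifted {A C : Matrix (Fin n) (Fin n) ℂ} (hA : A.IsHermitian)
    (hC : C.IsHermitian) (μ lam : ℝ) : (shifted A C μ lam).IsHermitian := by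
  unfold shifted
  refine (hA.sub ?_).sub ?_
  · simp [IsHermitian, conjTranspose_smul, hC.eq]
  · simp [IsHermitian, conjTranspose_smul]

theorem op_shifted_apply (A C : Matrix (Fin n) (Fin n) ℂ) (μ lam : ℝ)
    (p : EuclideanSpace ℂ (Fin n)) :
    op (shifted A C μ lam) p = op A p - (μ : ℂ) • op C p - (lam : ℂ) • p := by
  simp only [op, shifted, map_sub, map_smul, map_one, _root_.sub_apply,
    _root_.smul_apply, one_apply_eq_self]

theorem mem_eigenvectorSet_iff (A C : Matrix (Fin n) (Fin n) ℂ) (μ lam : ℝ)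
    (x : EuclideanSpace ℂ (Fin n)) :
    x ∈ eigenvectorSet A C μ lam ↔
      op (shifted A C μ lam) x = 0 ∧ ‖x‖ = 1 ∧ ⟪x, op C x⟫_ℂ = 0 := by
  have h1 : (A - (μ : ℂ) • C) *ᵥ x.ofLp = (lam : ℂ) • x.ofLp ↔ op (shifted A C μ lam) x = 0 := by
    rw [← sub_eq_zero, ← (WithLp.linearEquiv 2 ℂ (Fin n → ℂ)).map_eq_zero_iff]
    simp [shifted, sub_mulVec, smul_mulVec]
  have h2 : star x.ofLp ⬝ᵥ x.ofLp = 1 ↔ ‖x‖ = 1 := by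
    rw [dotProduct_comm, ← EuclideanSpace.inner_eq_star_dotProduct, inner_self_eq_norm_sq_to_K]
    refine Iff.trans (b := ((‖x‖ ^ 2 : ℝ) : ℂ) = ((1 : ℝ) : ℂ)) (by push_cast; rfl) ?_
    rw [Complex.ofReal_inj]
    exact pow_eq_one_iff_of_nonneg (norm_nonneg x) two_ne_zero
  rw [inner_op, ← h1, ← h2]
  exact ⟨fun h => ⟨h.eigen, h.unit, h.isotropic⟩, fun h => ⟨h.1, h.2.2, h.2.1⟩⟩

/-- Closedness ensures that the distance to the set is attained. -/
theorem isClosed_eigenvectorSet (A C : Matrix (Fin n) (Fin n) ℂ) (μ lam : ℝ) :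
    IsClosed (eigenvectorSet A C μ lam) := by
  have : eigenvectorSet A C μ lam = {x | op (shifted A C μ lam) x = 0} ∩
      ({x | ‖x‖ = 1} ∩ {x | ⟪x, op C x⟫_ℂ = 0}) := by
    ext x; exact mem_eigenvectorSet_iff A C μ lam x
  rw [this]
  refine (isClosed_eq (by fun_prop) (by fun_prop)).inter
    ((isClosed_eq (by fun_prop) (by fun_prop)).inter (isClosed_eq (by fun_prop) (by fun_prop)))

theorem jacobianTop_mulVec_eq_zero_iff (A C : Matrix (Fin n) (Fin n) ℂ) (μ lam : ℝ)
    (x : EuclideanSpace ℂ (Fin n)) (w : Fin n ⊕ Fin 2 → ℂ) :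
    jacobianTop A C μ lam x *ᵥ w = 0 ↔
      op (shifted A C μ lam) (WithLp.toLp 2 (w ∘ Sum.inl)) =
        w (Sum.inr 0) • op C x + w (Sum.inr 1) • x := by
  rw [jacobianTop, fromCols_mulVec, ← sub_eq_zero (b := _ • op C x + _),
    ← (WithLp.linearEquiv 2 ℂ (Fin n → ℂ)).map_eq_zero_iff]
  refine Eq.congr_left ?_
  ext i
  simp [mulVec, dotProduct, Fin.sum_univ_two]
  ring

theorem jacobian_mulVec_eq_zero_iff (A : Matrix (Fin n) (Fin n) ℂ) {C : Matrix (Fin n) (Fin n) ℂ}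
    (hC : C.IsHermitian) (μ lam : ℝ)
    (x : EuclideanSpace ℂ (Fin n)) (w : Fin n ⊕ Fin 2 → ℂ) :
    jacobian A C μ lam x *ᵥ w = 0 ↔
      op (shifted A C μ lam) (WithLp.toLp 2 (w ∘ Sum.inl)) =
        w (Sum.inr 0) • op C x + w (Sum.inr 1) • x ∧
      ⟪op C x, WithLp.toLp 2 (w ∘ Sum.inl)⟫_ℂ = 0 ∧ ⟪x, WithLp.toLp 2 (w ∘ Sum.inl)⟫_ℂ = 0 := by
  have hs := isSymmetric_op hC x (WithLp.toLp 2 (w ∘ Sum.inl))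
  simp only [ContinuousLinearMap.coe_coe] at hs
  rw [← jacobianTop_mulVec_eq_zero_iff, hs, inner_op, EuclideanSpace.inner_eq_star_dotProduct,
    jacobian, fromRows_mulVec, dotProduct_mulVec, dotProduct_comm _ (star x.ofLp)]
  have h : (fromCols (of fun (i : Fin 2) (j : Fin n) => ![-(star x.ofLp ᵥ* C) j, -(star x.ofLp) j] i)
      (0 : Matrix (Fin 2) (Fin 2) ℂ)) *ᵥ w =
      ![-((star x.ofLp ᵥ* C) ⬝ᵥ (w ∘ Sum.inl)), -(star x.ofLp ⬝ᵥ (w ∘ Sum.inl))] := by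
    ext i
    fin_cases i <;> simp [mulVec, dotProduct]
  rw [h]
  constructor
  · intro h0
    refine ⟨funext fun i => congrFun h0 (Sum.inl i), ?_, ?_⟩
    · simpa using congrFun h0 (Sum.inr 0)
    · simpa using congrFun h0 (Sum.inr 1)
  · rintro ⟨h1, h2, h3⟩
    ext (i | i)
    · exact congrFun h1 i
    · fin_cases i
      · simpa using h2
      · simpa using h3

/-- The form in which nonsingularity is used at the given triplet and established at the current
iterate. -/
theorem isUnit_jacobian_iff (A : Matrix (Fin n) (Fin n) ℂ) {C : Matrix (Fin n) (Fin n) ℂ}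
    (hC : C.IsHermitian) (μ lam : ℝ) (x : EuclideanSpace ℂ (Fin n)) :
    IsUnit (jacobian A C μ lam x) ↔ ∀ (p : EuclideanSpace ℂ (Fin n)) (a b : ℂ),
      op (shifted A C μ lam) p = a • op C x + b • x → ⟪op C x, p⟫_ℂ = 0 → ⟪x, p⟫_ℂ = 0 →
      p = 0 ∧ a = 0 ∧ b = 0 := by
  rw [← mulVec_injective_iff_isUnit]
  constructor
  · intro h p a b h1 h2 h3
    have hw : jacobian A C μ lam x *ᵥ (Sum.elim p.ofLp ![a, b]) = 0 := by
      rw [jacobian_mulVec_eq_zero_iff A hC]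
      simpa using ⟨h1, h2, h3⟩
    have h0 := h (hw.trans (mulVec_zero _).symm)
    refine ⟨?_, ?_, ?_⟩
    · ext i; simpa using congrFun h0 (Sum.inl i)
    · simpa using congrFun h0 (Sum.inr 0)
    · simpa using congrFun h0 (Sum.inr 1)
  · intro h
    refine (injective_iff_map_eq_zero (jacobian A C μ lam x).mulVecLin).mpr fun w hw => ?_
    rw [mulVecLin_apply, jacobian_mulVec_eq_zero_iff A hC] at hw
    obtain ⟨h1, h2, h3⟩ := h _ _ _ hw.1 hw.2.1 hw.2.2
    ext (i | i)
    · simpa using congrFun (congrArg WithLp.ofLp h1) i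
    · fin_cases i
      exacts [h2, h3]

/-- At a nonsingular multiple 2D-eigentriplet the eigenspace is two-dimensional and `C` is indefinite
on it. -/
theorem exists_isDiagonalFrame_of_nonsingular {A C : Matrix (Fin n) (Fin n) ℂ}
    (hC : C.IsHermitian) {μ lam : ℝ} (hmult : 2 ≤ eigMultiplicity A C μ lam)
    {x : EuclideanSpace ℂ (Fin n)} (hx : IsNonsingularEigentriplet A C μ lam x) :
    ∃ u d, IsDiagonalFrame (op C) (LinearMap.ker (op (shifted A C μ lam) :
      EuclideanSpace ℂ (Fin n) →ₗ[ℂ] EuclideanSpace ℂ (Fin n))) u d ∧ 0 < d 0 ∧ d 1 < 0 := by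
  set S := LinearMap.ker (op (shifted A C μ lam) :
      EuclideanSpace ℂ (Fin n) →ₗ[ℂ] EuclideanSpace ℂ (Fin n)) with hS
  have hJ := (isUnit_jacobian_iff A hC μ lam x).mp hx.nonsingular
  obtain ⟨hxS, hx1, hxC⟩ := (mem_eigenvectorSet_iff A C μ lam x).mp hx.toIsEigentriplet
  replace hxS : x ∈ S := hxS
  have hinj : ∀ p ∈ S, ⟪op C x, p⟫_ℂ = 0 → ⟪x, p⟫_ℂ = 0 → p = 0 := fun p hp h1 h2 =>
    (hJ p 0 0 (by rw [zero_smul, zero_smul, add_zero]; exact hp) h1 h2).1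
  -- Nonsingularity with a = b = 0 makes the two functionals ⟪C x, ·⟫ and ⟪x, ·⟫ jointly injective
  -- on `S`.
  have hle : Module.finrank ℂ S ≤ 2 := by
    let f : S →ₗ[ℂ] (Fin 2 → ℂ) := LinearMap.pi
      ![(innerSL ℂ (op C x) : _ →ₗ[ℂ] ℂ) ∘ₗ S.subtype, (innerSL ℂ x : _ →ₗ[ℂ] ℂ) ∘ₗ S.subtype]
    have hf : Function.Injective f := by
      rw [injective_iff_map_eq_zero]
      intro p hp
      have h0 := congrFun hp 0
      have h1 := congrFun hp 1
      simp only [f, LinearMap.pi_apply] at h0 h1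
      exact Subtype.ext (hinj p p.2 h0 h1)
    simpa using LinearMap.finrank_le_finrank_of_injective hf
  have hge : eigMultiplicity A C μ lam = Module.finrank ℂ S := by
    let e := (WithLp.linearEquiv 2 ℂ (Fin n → ℂ)).symm
    have : (Module.End.eigenspace (toLin' (A - (μ : ℂ) • C)) (lam : ℂ)).map
        (e : (Fin n → ℂ) →ₗ[ℂ] EuclideanSpace ℂ (Fin n)) = S := by
      ext p
      rw [Submodule.mem_map_equiv, Module.End.mem_eigenspace_iff, hS, LinearMap.mem_ker,
        ContinuousLinearMap.coe_coe, toLin'_apply, ← sub_eq_zero,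
        ← (WithLp.linearEquiv 2 ℂ (Fin n → ℂ)).map_eq_zero_iff]
      simp [shifted, sub_mulVec, smul_mulVec, e]
    rw [eigMultiplicity, ← this, LinearEquiv.finrank_map_eq]
  obtain ⟨u, d, hu, hord⟩ := exists_isDiagonalFrame (isSymmetric_op hC)
    (show Module.finrank ℂ S = 2 by omega)
  refine ⟨u, d, hu, ?_⟩
  have hq := hu.inner_apply_self hxS
  rw [hxC] at hq
  norm_cast at hq
  have hn := hu.norm_sq_eq hxS
  -- If `C` were semidefinite on `S`, both terms of the isotropy relation would vanish and C x would
  -- be orthogonal to `S`. A vector of `S` orthogonal to `x` would then be zero by `hinj`, forcing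
  -- the coordinates of the unit vector `x` to vanish.
  by_contra hcon
  have hdw : ∀ i, d i * ‖⟪u i, x⟫_ℂ‖ ^ 2 = 0 := by
    have hcases : (0 ≤ d 0 ∧ 0 ≤ d 1) ∨ (d 0 ≤ 0 ∧ d 1 ≤ 0) := by
      by_cases h0 : 0 < d 0
      · exact Or.inl ⟨h0.le, not_lt.mp fun h1 => hcon ⟨h0, h1⟩⟩
      · exact Or.inr ⟨not_lt.mp h0, hord.trans (not_lt.mp h0)⟩
    intro i
    rcases hcases with ⟨h0, h1⟩ | ⟨h0, h1⟩
    · have k0 := mul_nonneg h0 (sq_nonneg ‖⟪u 0, x⟫_ℂ‖)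
      have k1 := mul_nonneg h1 (sq_nonneg ‖⟪u 1, x⟫_ℂ‖)
      fin_cases i
      · change d 0 * ‖⟪u 0, x⟫_ℂ‖ ^ 2 = 0; linarith
      · change d 1 * ‖⟪u 1, x⟫_ℂ‖ ^ 2 = 0; linarith
    · have k0 := mul_nonpos_of_nonpos_of_nonneg h0 (sq_nonneg ‖⟪u 0, x⟫_ℂ‖)
      have k1 := mul_nonpos_of_nonpos_of_nonneg h1 (sq_nonneg ‖⟪u 1, x⟫_ℂ‖)
      fin_cases i
      · change d 0 * ‖⟪u 0, x⟫_ℂ‖ ^ 2 = 0; linarith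
      · change d 1 * ‖⟪u 1, x⟫_ℂ‖ ^ 2 = 0; linarith
  have hcoord : ∀ i, ⟪op C x, u i⟫_ℂ = 0 := fun i => by
    rw [← inner_conj_symm, hu.inner_apply_coord hxS]
    rcases mul_eq_zero.mp (hdw i) with h | h
    · simp [h]
    · have : ⟪u i, x⟫_ℂ = 0 := by simpa using h
      simp [this]
  -- the vector of `S` orthogonal to `x`
  have hy := hinj (conj ⟪u 1, x⟫_ℂ • u 0 - conj ⟪u 0, x⟫_ℂ • u 1)
    (S.sub_mem (S.smul_mem _ (hu.mem 0)) (S.smul_mem _ (hu.mem 1)))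
    (by rw [inner_sub_right, inner_smul_right, inner_smul_right, hcoord, hcoord]; simp)
    (by
      rw [inner_sub_right, inner_smul_right, inner_smul_right, inner_conj_symm, inner_conj_symm]
      ring)
  have h0 : ⟪u 1, x⟫_ℂ = 0 := by
    have := congrArg (fun v => ⟪u 0, v⟫_ℂ) hy
    simp only [inner_sub_right, inner_smul_right, hu.inner_eq, inner_zero_right] at this
    rw [← map_eq_zero (starRingEnd ℂ)]
    simpa [-inner_conj_symm] using this
  have h1 : ⟪u 0, x⟫_ℂ = 0 := by
    have := congrArg (fun v => ⟪u 1, v⟫_ℂ) hy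
    simp only [inner_sub_right, inner_smul_right, hu.inner_eq, inner_zero_right] at this
    rw [← map_eq_zero (starRingEnd ℂ)]
    simpa [-inner_conj_symm] using this
  rw [h0, h1, hx1] at hn
  norm_num at hn

/-- The `j`-th column of `V` as a vector of Euclidean space. -/
noncomputable def colVec (V : Matrix (Fin n) (Fin 2) ℂ) (j : Fin 2) : EuclideanSpace ℂ (Fin n) :=
  WithLp.toLp 2 (V.col j)

theorem inner_colVec_op (B : Matrix (Fin n) (Fin n) ℂ) (V : Matrix (Fin n) (Fin 2) ℂ)
    (i j : Fin 2) : ⟪colVec V i, op B (colVec V j)⟫_ℂ = (Vᴴ * B * V) i j := by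
  rw [inner_op, Matrix.mul_assoc, Matrix.mul_apply']
  rfl

theorem inner_colVec (V : Matrix (Fin n) (Fin 2) ℂ)
    (i j : Fin 2) : ⟪colVec V i, colVec V j⟫_ℂ = (Vᴴ * V) i j := by
  have := inner_colVec_op 1 V i j
  rw [Matrix.mul_one] at this
  rw [← this]
  simp

theorem toLp_mulVec (V : Matrix (Fin n) (Fin 2) ℂ) (z : Fin 2 → ℂ) :
    WithLp.toLp 2 (V *ᵥ z) = z 0 • colVec V 0 + z 1 • colVec V 1 := by
  ext i
  simp [colVec, mulVec, dotProduct, Fin.sum_univ_two, mul_comm]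

theorem span_colVec (V : Matrix (Fin n) (Fin 2) ℂ) :
    Submodule.span ℂ (Set.range (colVec V)) = (LinearMap.range V.mulVecLin).map
      ((WithLp.linearEquiv 2 ℂ (Fin n → ℂ)).symm : (Fin n → ℂ) →ₗ[ℂ] EuclideanSpace ℂ (Fin n)) := by
  rw [range_mulVecLin, Submodule.map_span, ← Set.range_comp]
  rfl

end Translation

end TwoDEVP

namespace TwoDEVP

open Matrix
open scoped InnerProductSpace ComplexConjugate

/-! ### The projection subspace and the update -/

section Projection

variable {n : ℕ}

theorem IsBasisMatrix.mulVec_mem {ι : Type} {W : Matrix ι (Fin 2) ℂ} {S : Submodule ℂ (ι → ℂ)}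
    (h : IsBasisMatrix W S) (z : Fin 2 → ℂ) : W *ᵥ z ∈ S := by
  have hr : LinearMap.range W.mulVecLin = S := (range_mulVecLin W).trans h.2
  exact hr ▸ LinearMap.mem_range_self W.mulVecLin z

theorem IsProjectionMatrix.isDiagonalFrame {A C : Matrix (Fin n) (Fin n) ℂ} {μ lam : ℝ}
    {x : EuclideanSpace ℂ (Fin n)} {V : Matrix (Fin n) (Fin 2) ℂ}
    (h : IsProjectionMatrix A C μ lam x V) :
    IsDiagonalFrame (op C) (Submodule.span ℂ (Set.range (colVec V))) (colVec V) (cEntry C V) where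
  orthonormal := by
    rw [orthonormal_iff_ite]
    intro i j
    rw [inner_colVec, h.orthonormal, Matrix.one_apply]
  span_eq := rfl
  inner_apply i j := by
    rw [inner_colVec_op, h.diag, diagonal_apply]

/-- The last two entries of a null vector serve as coefficients. The property concerns only the
column space, so it passes from `W` to `V`. -/
theorem IsProjectionMatrix.exists_eq {A C : Matrix (Fin n) (Fin n) ℂ} {μ lam : ℝ}
    {x : EuclideanSpace ℂ (Fin n)} {V : Matrix (Fin n) (Fin 2) ℂ}
    (h : IsProjectionMatrix A C μ lam x V) {p : EuclideanSpace ℂ (Fin n)}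
    (hp : p ∈ Submodule.span ℂ (Set.range (colVec V))) :
    ∃ a b : ℂ, op (shifted A C μ lam) p = a • op C x + b • x := by
  obtain ⟨W, R, hWR, hrange⟩ := h.range_eq
  rw [span_colVec, hrange] at hp
  obtain ⟨_, ⟨z, rfl⟩, rfl⟩ := hp
  have hmem : fromRows W R *ᵥ z ∈ LinearMap.ker (jacobianTop A C μ lam x).mulVecLin := hWR.mulVec_mem z
  rw [LinearMap.mem_ker, mulVecLin_apply, jacobianTop_mulVec_eq_zero_iff] at hmem
  refine ⟨_, _, Eq.trans ?_ hmem⟩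
  rw [fromRows_mulVec, Sum.elim_comp_inl]
  rfl

/-- The top n rows of an invertible matrix of order n + 2 are surjective; rank-nullity leaves
dimension 2. -/
theorem finrank_ker_jacobianTop {A C : Matrix (Fin n) (Fin n) ℂ} {μ lam : ℝ}
    {x : EuclideanSpace ℂ (Fin n)} (h : IsUnit (jacobian A C μ lam x)) :
    Module.finrank ℂ (LinearMap.ker (jacobianTop A C μ lam x).mulVecLin) = 2 := by
  have hsurj : Function.Surjective (jacobianTop A C μ lam x).mulVecLin := by
    intro y
    obtain ⟨w, hw⟩ := mulVec_surjective_iff_isUnit.mpr h (Sum.elim y 0)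
    refine ⟨w, funext fun i => ?_⟩
    have := congrFun hw (Sum.inl i)
    rw [jacobian, fromRows_mulVec] at this
    exact this
  have h1 := (jacobianTop A C μ lam x).mulVecLin.finrank_range_add_finrank_ker
  rw [LinearMap.range_eq_top.mpr hsurj, finrank_top] at h1
  simp at h1
  omega

theorem exists_isProjectionMatrix {A C : Matrix (Fin n) (Fin n) ℂ} (hC : C.IsHermitian) {μ lam : ℝ}
    {x : EuclideanSpace ℂ (Fin n)} (h : IsUnit (jacobian A C μ lam x)) :
    ∃ V, IsProjectionMatrix A C μ lam x V := by
  set N := LinearMap.ker (jacobianTop A C μ lam x).mulVecLin with hN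
  have hJ := (isUnit_jacobian_iff A hC μ lam x).mp h
  let b := Module.finBasisOfFinrankEq ℂ N (finrank_ker_jacobianTop h)
  let W : Matrix (Fin n) (Fin 2) ℂ := of fun i j => (b j : Fin n ⊕ Fin 2 → ℂ) (Sum.inl i)
  let R : Matrix (Fin 2) (Fin 2) ℂ := of fun i j => (b j : Fin n ⊕ Fin 2 → ℂ) (Sum.inr i)
  have hcol : (fun j => (fromRows W R).col j) = fun j => (b j : Fin n ⊕ Fin 2 → ℂ) := by
    ext j (i | i) <;> rfl
  have hWR : IsBasisMatrix (fromRows W R) N := by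
    rw [IsBasisMatrix, hcol]
    refine ⟨b.linearIndependent.map' N.subtype N.ker_subtype, ?_⟩
    have hr : Set.range (fun j => (b j : Fin n ⊕ Fin 2 → ℂ)) = N.subtype '' Set.range b := by
      ext; simp
    rw [hr, Submodule.span_image, b.span_eq]
    simp
  -- A null vector with zero first block gives a C x + b x = 0, and nonsingularity forces a = b = 0.
  -- Hence `W` keeps rank 2.
  have hWinj : Function.Injective W.mulVecLin := by
    rw [injective_iff_map_eq_zero]
    intro z hz
    have hmem : fromRows W R *ᵥ z ∈ N := hWR.mulVec_mem z
    rw [hN, LinearMap.mem_ker, mulVecLin_apply, jacobianTop_mulVec_eq_zero_iff] at hmem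
    have hz' : W *ᵥ z = 0 := hz
    have h0 : WithLp.toLp 2 ((fromRows W R *ᵥ z) ∘ Sum.inl) = (0 : EuclideanSpace ℂ (Fin n)) := by
      rw [fromRows_mulVec, Sum.elim_comp_inl, hz']; rfl
    rw [h0, map_zero] at hmem
    obtain ⟨-, h1, h2⟩ := hJ 0 _ _ (by rw [map_zero]; exact hmem) (inner_zero_right _)
      (inner_zero_right _)
    have hall : fromRows W R *ᵥ z = 0 := by
      ext (i | i)
      · rw [fromRows_mulVec, hz']; rfl
      · fin_cases i
        exacts [h1, h2]
    exact (mulVec_injective_iff (M := fromRows W R)).mpr hWR.1 (hall.trans (mulVec_zero _).symm)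
  set e := (WithLp.linearEquiv 2 ℂ (Fin n → ℂ)).symm with he
  let Q : Submodule ℂ (EuclideanSpace ℂ (Fin n)) := (LinearMap.range W.mulVecLin).map
      (e : (Fin n → ℂ) →ₗ[ℂ] EuclideanSpace ℂ (Fin n))
  have hQ : Module.finrank ℂ Q = 2 := by
    rw [LinearEquiv.finrank_map_eq, LinearMap.finrank_range_of_inj hWinj]
    simp
  obtain ⟨v, c, hv, hord⟩ := exists_isDiagonalFrame (isSymmetric_op hC) hQ
  let V : Matrix (Fin n) (Fin 2) ℂ := of fun i j => v j i
  have hVv : colVec V = v := by ext j i; rfl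
  have hVC : ∀ i j, (Vᴴ * C * V) i j = if i = j then (c i : ℂ) else 0 := fun i j => by
    rw [← inner_colVec_op, hVv, hv.inner_apply]
  have hc : cEntry C V = c := by
    ext i; simp [cEntry, hVC]
  refine ⟨V, ?_, ⟨W, R, hWR, ?_⟩, ?_, ?_⟩
  · ext i j
    rw [← inner_colVec, hVv, hv.inner_eq, Matrix.one_apply]
  · have h1 := span_colVec V
    rw [hVv, hv.span_eq] at h1
    exact (Submodule.map_injective_of_injective e.injective h1).symm
  · ext i j
    rw [hVC, hc, diagonal_apply]
  · rwa [hc]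

theorem isIndefinite_of_cEntry {C : Matrix (Fin n) (Fin n) ℂ} {V : Matrix (Fin n) (Fin 2) ℂ}
    (hdiag : Vᴴ * C * V = diagonal fun i => (cEntry C V i : ℂ))
    (h0 : 0 < cEntry C V 0) (h1 : cEntry C V 1 < 0) : IsIndefinite (Vᴴ * C * V) := by
  rw [hdiag]
  refine ⟨⟨Pi.single 0 1, ?_⟩, ⟨Pi.single 1 1, ?_⟩⟩ <;>
    simpa [dotProduct, mulVec_diagonal, Fin.sum_univ_two]

theorem exists_update (A C : Matrix (Fin n) (Fin n) ℂ) (V : Matrix (Fin n) (Fin 2) ℂ) (μ lam : ℝ) :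
    ∃ (μ' lam' : ℝ) (x' : EuclideanSpace ℂ (Fin n)),
      ((Vᴴ * A * V) 0 1 ≠ 0 ∧ IsSimpleUpdate A C V μ lam μ' lam' x') ∨
      ((Vᴴ * A * V) 0 1 = 0 ∧ IsMultipleUpdate A C V μ' lam' x') := by
  by_cases h : (Vᴴ * A * V) 0 1 = 0
  · exact ⟨_, _, _, Or.inr ⟨h, rfl, rfl, rfl⟩⟩
  · have hfin : (phases A V).Finite := (Set.finite_singleton _).insert _
    obtain ⟨α, hα, hmin⟩ := hfin.exists_minimalFor
      (fun α => |μ - ritzNu A C V α| + |lam - ritzTheta A C V α|) _ ⟨_, Set.mem_insert _ _⟩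
    refine ⟨_, _, _, Or.inl ⟨h, α, hα, fun β hβ => ?_, rfl, rfl, rfl⟩⟩
    rcases le_total (|μ - ritzNu A C V α| + |lam - ritzTheta A C V α|)
      (|μ - ritzNu A C V β| + |lam - ritzTheta A C V β|) with h | h
    · exact h
    · exact hmin hβ h

/-- The minimality of α plays no role: either phase yields a unit isotropic vector, and all of these
satisfy the bounds. -/
theorem update_estimates {A C : Matrix (Fin n) (Fin n) ℂ} {V : Matrix (Fin n) (Fin 2) ℂ}
    {μs lams μ lam η δ : ℝ} (hη : IsNearPencil A C V μs lams η)
    (hdiag : Vᴴ * C * V = diagonal fun i => (cEntry C V i : ℂ)) (hδ : 0 < δ)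
    (h0 : δ ≤ cEntry C V 0) (h1 : cEntry C V 1 ≤ -δ) {μ' lam' : ℝ}
    {x' : EuclideanSpace ℂ (Fin n)}
    (h : ((Vᴴ * A * V) 0 1 ≠ 0 ∧ IsSimpleUpdate A C V μ lam μ' lam' x') ∨
      ((Vᴴ * A * V) 0 1 = 0 ∧ IsMultipleUpdate A C V μ' lam' x')) :
    |μ' - μs| ≤ 4 * η / δ ∧ |lam' - lams| ≤ 4 * η ∧
      ∃ α : ℂ, ‖α‖ = 1 ∧ x' = WithLp.toLp 2 (V *ᵥ ritzVec C V α) := by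
  rcases h with ⟨ha, α, hα, -, rfl, rfl, rfl⟩ | ⟨-, hm⟩
  · have hα1 := norm_eq_one_of_mem_phases ha hα
    exact ⟨abs_ritzNu_sub_le hη hdiag hδ h0 h1 hα1,
      abs_ritzTheta_sub_le hη (by linarith) (by linarith) hα1, α, hα1, rfl⟩
  · obtain ⟨e1, e2⟩ := abs_multipleUpdate_sub_le hη hδ h0 h1 hm
    exact ⟨e1, e2, 1, norm_one, hm.2.2⟩

/-- A 2D Ritz vector is a unit isotropic vector of the projection subspace. -/
theorem IsProjectionMatrix.ritzVec_mem {A C : Matrix (Fin n) (Fin n) ℂ} {μ lam : ℝ}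
    {x : EuclideanSpace ℂ (Fin n)} {V : Matrix (Fin n) (Fin 2) ℂ}
    (h : IsProjectionMatrix A C μ lam x V) (h0 : 0 < cEntry C V 0) (h1 : cEntry C V 1 < 0) {α : ℂ}
    (hα : ‖α‖ = 1) :
    WithLp.toLp 2 (V *ᵥ ritzVec C V α) ∈ Submodule.span ℂ (Set.range (colVec V)) ∧
    ‖WithLp.toLp 2 (V *ᵥ ritzVec C V α)‖ = 1 ∧
    ⟪WithLp.toLp 2 (V *ᵥ ritzVec C V α), op C (WithLp.toLp 2 (V *ᵥ ritzVec C V α))⟫_ℂ = 0 := by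
  have hv := h.isDiagonalFrame
  have hn := normSq_ritzVec_add h0 h1 hα
  have hi := isotropic_ritzVec h0 h1 hα
  rw [toLp_mulVec]
  set z := ritzVec C V α
  have hmem : z 0 • colVec V 0 + z 1 • colVec V 1 ∈ Submodule.span ℂ (Set.range (colVec V)) :=
    Submodule.add_mem _ (Submodule.smul_mem _ _ (hv.mem 0)) (Submodule.smul_mem _ _ (hv.mem 1))
  have hc0 : ⟪colVec V 0, z 0 • colVec V 0 + z 1 • colVec V 1⟫_ℂ = z 0 := by
    simp only [inner_add_right, inner_smul_right, hv.inner_eq]; simp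
  have hc1 : ⟪colVec V 1, z 0 • colVec V 0 + z 1 • colVec V 1⟫_ℂ = z 1 := by
    simp only [inner_add_right, inner_smul_right, hv.inner_eq]; simp
  refine ⟨hmem, ?_, ?_⟩
  · have := hv.norm_sq_eq hmem
    rw [hc0, hc1, hn] at this
    exact (pow_eq_one_iff_of_nonneg (norm_nonneg _) two_ne_zero).mp this
  · rw [hv.inner_apply_self hmem, hc0, hc1, hi, Complex.ofReal_zero]

/-- A_k - μ* C_k - λ* I is the compression of M to the columns of `V`, which lie within η of ker M;
`inner_apply_eq_of_ker` squares η. -/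
theorem isNearPencil_of_near {A C : Matrix (Fin n) (Fin n) ℂ} (hA : A.IsHermitian)
    (hC : C.IsHermitian) {μ lam μs lams η : ℝ}
    {x : EuclideanSpace ℂ (Fin n)} {V : Matrix (Fin n) (Fin 2) ℂ}
    (h : IsProjectionMatrix A C μ lam x V)
    (hQ : ∀ p ∈ Submodule.span ℂ (Set.range (colVec V)),
      ‖p - (LinearMap.ker (op (shifted A C μs lams) : EuclideanSpace ℂ (Fin n) →ₗ[ℂ]
        EuclideanSpace ℂ (Fin n))).starProjection p‖ ≤ η * ‖p‖) :
    IsNearPencil A C V μs lams (‖op (shifted A C μs lams)‖ * η ^ 2) := by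
  have hv := h.isDiagonalFrame
  intro i j
  have hr : ∀ i, ‖colVec V i - (LinearMap.ker (op (shifted A C μs lams) :
      EuclideanSpace ℂ (Fin n) →ₗ[ℂ] EuclideanSpace ℂ (Fin n))).starProjection (colVec V i)‖ ≤ η :=
    fun i => by simpa [hv.norm_eq_one] using hQ _ (hv.mem i)
  have hη : 0 ≤ η := (norm_nonneg _).trans (hr 0)
  have e : (Vᴴ * A * V) i j - (if i = j then ((μs * cEntry C V i + lams : ℝ) : ℂ) else 0) =
      ⟪colVec V i, op (shifted A C μs lams) (colVec V j)⟫_ℂ := by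
    rw [op_shifted_apply, inner_sub_right, inner_sub_right, inner_smul_right, inner_smul_right,
      inner_colVec_op, hv.inner_apply, hv.inner_eq]
    split_ifs <;> push_cast <;> ring
  rw [e, inner_apply_eq_of_ker (isSymmetric_op (isHermitian_shifted hA hC μs lams))]
  refine (norm_inner_le_norm _ _).trans ?_
  calc _ ≤ η * (‖op (shifted A C μs lams)‖ * η) := by
        gcongr
        · exact hr i
        · exact ((op (shifted A C μs lams)).le_opNorm _).trans (by gcongr; exact hr j)
    _ = _ := by ring

end Projection

end TwoDEVP

/-! ### The convergence theorem -/

theorem theorem6p4 {n : ℕ} (A C : Matrix (Fin n) (Fin n) ℂ)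
    (hA : A.IsHermitian) (hC : C.IsHermitian) (hCind : TwoDEVP.IsIndefinite C)
    (μs lams : ℝ) (hmult : 2 ≤ TwoDEVP.eigMultiplicity A C μs lams)
    (hns : ∃ xs, TwoDEVP.IsNonsingularEigentriplet A C μs lams xs) :
    ∃ ε₀ κ₁ κ₂ κ₃ : ℝ, 0 < ε₀ ∧ 0 < κ₁ ∧ 0 < κ₂ ∧ 0 < κ₃ ∧
      ∀ (ε μ lam : ℝ) (x : EuclideanSpace ℂ (Fin n)), ε ≤ 1 → ε ≤ ε₀ →
        |μ - μs| ≤ ε ^ 2 → |lam - lams| ≤ ε ^ 2 →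
        Metric.infDist x (TwoDEVP.eigenvectorSet A C μs lams) ≤ ε →
        (∃ (μ' lam' : ℝ) (x' : EuclideanSpace ℂ (Fin n)),
          TwoDEVP.IsStep A C μ lam x μ' lam' x') ∧
        ∀ (μ' lam' : ℝ) (x' : EuclideanSpace ℂ (Fin n)),
          TwoDEVP.IsStep A C μ lam x μ' lam' x' →
          |μ' - μs| ≤ κ₁ * ε ^ 4 ∧ |lam' - lams| ≤ κ₂ * ε ^ 4 ∧
          Metric.infDist x' (TwoDEVP.eigenvectorSet A C μs lams) ≤ κ₃ * ε ^ 2 := by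
  open TwoDEVP in
  obtain ⟨x₀, hx₀⟩ := hns
  obtain ⟨u, d, hu, hd0, hd1⟩ := exists_isDiagonalFrame_of_nonsingular hC hmult hx₀
  have hM := isSymmetric_op (isHermitian_shifted hA hC μs lams)
  have hCs := isSymmetric_op hC
  obtain ⟨ε₁, κ, hε₁, hκ, hpert⟩ := hu.exists_perturbation_bounds hM hCs hd0 hd1
  obtain ⟨κ', hκ', hnear⟩ := hu.exists_isotropic_near_of_near hCs hd0 hd1
  set M := op (shifted A C μs lams) with hMdef
  set S := LinearMap.ker (M : EuclideanSpace ℂ (Fin n) →ₗ[ℂ] EuclideanSpace ℂ (Fin n)) with hS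
  have hm : 0 < min (d 0) (-d 1) := lt_min hd0 (by linarith)
  obtain ⟨δ, hδ, hδ0, hδ1⟩ : ∃ δ : ℝ, 0 < δ ∧ δ ≤ d 0 / 8 ∧ d 1 / 8 ≤ -δ :=
    ⟨min (d 0) (-d 1) / 8, by positivity, by linarith [min_le_left (d 0) (-d 1)],
      by linarith [min_le_right (d 0) (-d 1)]⟩
  -- The last two thresholds give η = κ ε² ≤ 1/2 and 16‖C‖η ≤ min (d 0) (-d 1), as preservation of
  -- indefiniteness requires. The pencil error is ‖M‖κ²ε⁴; the added 1 keeps the constants positive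
  -- when M = 0.
  refine ⟨min ε₁ (min (1 / (2 * κ)) (min (d 0) (-d 1) / (16 * (‖op C‖ + 1) * κ))),
    4 * ((‖M‖ + 1) * κ ^ 2) / δ, 4 * ((‖M‖ + 1) * κ ^ 2), κ' * κ, by positivity, by positivity,
    by positivity, by positivity, ?_⟩
  intro ε μ lam x hε1 hε hμ hlam hx
  have hε0 : 0 ≤ ε := Metric.infDist_nonneg.trans hx
  have hεa : κ * ε ^ 2 ≤ 1 / 2 := by
    have := hε.trans ((min_le_right _ _).trans (min_le_left _ _))
    rw [le_div_iff₀ (by positivity)] at this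
    nlinarith [mul_le_mul_of_nonneg_left hε1 (mul_nonneg hκ.le hε0)]
  have hεb : 16 * ‖op C‖ * (κ * ε ^ 2) ≤ min (d 0) (-d 1) := by
    have := hε.trans ((min_le_right _ _).trans (min_le_right _ _))
    rw [le_div_iff₀ (by positivity)] at this
    have h2 : ε ^ 2 ≤ ε := by nlinarith
    calc 16 * ‖op C‖ * (κ * ε ^ 2) ≤ 16 * (‖op C‖ + 1) * (κ * ε) := by gcongr; linarith
      _ ≤ _ := by linarith
  -- The nearest eigenvector `xs` varies with `x`, which is harmless because `hpert` is uniform over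
  -- the eigenvector set.
  obtain ⟨xs, hxs, hdist⟩ := (isClosed_eigenvectorSet A C μs lams).exists_infDist_eq_dist
    ⟨x₀, hx₀.toIsEigentriplet⟩ x
  obtain ⟨hxsM, hxs1, hxsC⟩ := (mem_eigenvectorSet_iff A C μs lams xs).mp hxs
  rw [hdist, dist_eq_norm] at hx
  have hshift : ∀ p, op (shifted A C μ lam) p =
      M p - ((μ - μs : ℝ) : ℂ) • op C p - ((lam - lams : ℝ) : ℂ) • p := fun p => by
    rw [hMdef, op_shifted_apply, op_shifted_apply, Complex.ofReal_sub, Complex.ofReal_sub, sub_smul,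
      sub_smul]
    abel
  have hkey := hpert ε (μ - μs) (lam - lams) x xs hε0 hε1 (hε.trans (min_le_left _ _)) hμ hlam
    hxsM hxs1 hxsC hx
  have hJ : IsUnit (jacobian A C μ lam x) := by
    rw [isUnit_jacobian_iff A hC]
    intro p a b h1 h2 h3
    rw [hshift] at h1
    exact (hkey p a b h1).2 h2 h3
  have hQ : ∀ V, IsProjectionMatrix A C μ lam x V →
      ∀ p ∈ Submodule.span ℂ (Set.range (colVec V)),
        ‖p - S.starProjection p‖ ≤ κ * ε ^ 2 * ‖p‖ := by
    intro V hV p hp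
    obtain ⟨a, b, hab⟩ := hV.exists_eq hp
    rw [hshift] at hab
    exact (hkey p a b hab).1
  have hc : ∀ V, IsProjectionMatrix A C μ lam x V → δ ≤ cEntry C V 0 ∧ cEntry C V 1 ≤ -δ := by
    intro V hV
    obtain ⟨h0, h1⟩ := hu.indefinite_of_near hV.isDiagonalFrame hCs (by positivity) hεa hεb hd0 hd1
      hV.ordered (hQ V hV)
    exact ⟨hδ0.trans h0, h1.trans hδ1⟩
  constructor
  · obtain ⟨V, hV⟩ := exists_isProjectionMatrix hC hJ
    obtain ⟨h0, h1⟩ := hc V hV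
    obtain ⟨μ', lam', x', hup⟩ := exists_update A C V μ lam
    exact ⟨μ', lam', x', hJ, V, hV,
      isIndefinite_of_cEntry hV.diag (by linarith) (by linarith), hup⟩
  · rintro μ' lam' x' ⟨-, V, hV, -, hup⟩
    obtain ⟨h0, h1⟩ := hc V hV
    have hpencil := isNearPencil_of_near hA hC hV (hQ V hV)
    obtain ⟨e1, e2, α, hα, rfl⟩ := update_estimates hpencil hV.diag hδ h0 h1 hup
    have hη : 4 * (‖M‖ * (κ * ε ^ 2) ^ 2) ≤ 4 * ((‖M‖ + 1) * κ ^ 2) * ε ^ 4 := by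
      have : 0 ≤ κ ^ 2 * ε ^ 4 := by positivity
      nlinarith
    refine ⟨e1.trans ?_, e2.trans hη, ?_⟩
    · rw [div_mul_eq_mul_div]
      gcongr
    · obtain ⟨hmem, hn1, hiso⟩ := hV.ritzVec_mem (by linarith) (by linarith) hα
      obtain ⟨y, hyS, hy1, hyC, hy⟩ := hnear _ (κ * ε ^ 2) (by linarith) hn1 hiso
        (by simpa [hn1] using hQ V hV _ hmem)
      have hyX : y ∈ eigenvectorSet A C μs lams :=
        (mem_eigenvectorSet_iff A C μs lams y).mpr ⟨hyS, hy1, hyC⟩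
      refine (Metric.infDist_le_dist_of_mem hyX).trans ?_
      rw [dist_eq_norm, mul_assoc]
      exact hy
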